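/- **Setting.** Let $X$ be a real vector space with a $\sigma$-algebra $\mathcal F$ stable under dilations (of nonzero ratio) and translations. The gauge of a convex set $C\subset X$ is $M_C(x)=\inf\{t\ge 0: x\in tC\}\in[0,\infty]$; $C$ is *internal* if $M_C<\infty$ everywhere and $C=\{M_C<1\}$. Let $\mathcal C_0(\mathcal F)$ be the set of measurable internal convex sets. $(X,\mathcal C_0,\mathcal F,\tau)$ is a *measurable locally convex space* if $\mathcal C_0\subset\mathcal C_0(\mathcal F)$ is a non-empty family of symmetric sets, stable under finite intersections and dilations of nonzero ratio, with $\bigcap\mathcal C_0=\{0\}$, if $\tau$ is the locally convex topology for which $\mathcal C_0$ is a fundamental system of neighbourhoods of $0$, and if every continuous linear form on $X$ is measurable; $X^*$ is the space of these forms. Let $d\ge1$. A *box* is a translate (by an element of $\mathbb Z^d$) of $\Lambda(n)=[0,n[^d\cap\mathbb Z^d$, $n\ge1$. For a box $\Lambda$ put $\mathfrak m_\Lambda(\sigma)=|\Lambda|^{-1}\sum_{z\in\Lambda}\sigma(z)$, $\sigma\in X^{\mathbb Z^d}$. For a finite set $S\subset\mathbb Z^d$, $\mathcal F_S$ is the $\sigma$-algebra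 on $X^{\mathbb Z^d}$ generated by the maps $\mathfrak m_\Lambda$ into $(X,\mathcal F)$, $\Lambda\subset S$ a box. A *compatible translation-invariant system* is a family of probability measures $\mu_\Lambda$ on $\mathcal F_\Lambda$, one for each box, with $\mu_{\Lambda_2}=\mu_{\Lambda_1}$ on $\mathcal F_{\Lambda_1}$ whenever $\Lambda_1\subset\Lambda_2$, and $\mu_{\Lambda+z}(A+z)=\mu_\Lambda(A)$ for all $A\in\mathcal F_\Lambda$, $z\in\mathbb Z^d$, where $A+z=\{\sigma(\cdot-z):\sigma\in A\}$. Write $\mathbb P(A)=\mu_\Lambda(A)$ for $A\in\mathcal F_\Lambda$, and similarly for conditional probabilities. The system is *carried by* $E\subset X^{\mathbb Z^d}$ if, for every box $\Lambda$ and all $A,B\in\mathcal F_\Lambda$, $A\cap E=B\cap E$ implies $\mu_\Lambda(A)=\mu_\Lambda(B)$. The system is: - *lower asymptotically decoupled* if there are $g,c:\mathbb N^*\to[0,\infty[$ with $g(m)/m\to0$ and $c(m)/|\Lambda(m)|\to0$ such that for all $m\ge1$, all finite $S\subset\mathbb Z^d$, $A\in\mathcal F_{\Lambda(m)}$ and $B\in\mathcal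 F_S$: if the sup-norm distance from $S$ to $\Lambda(m)$ is $>g(m)$, then $\mathbb P(A\cap B)\ge e^{-c(m)}\mathbb P(A)\mathbb P(B)$; - *locally controlled* if there are $t,\alpha:\mathcal C_0(\mathcal F)\to\,]0,\infty[$ such that for every $C\in\mathcal C_0(\mathcal F)$ and every box $\Lambda\ni0$, almost surely $\mathbb P(\sigma(0)\in t(C)C\mid\mathcal F_{\Lambda\setminus\{0\}})\ge\alpha(C)$; - *locally convex-tight on* $D\subset X$ if for each $\gamma>0$ there is $K\in\mathcal F$ with $K\cap D$ convex and relatively compact such that for every box $\Lambda\ni0$, almost surely $\mathbb P(\sigma(0)\in K\mid\mathcal F_{\Lambda\setminus\{0\}})\ge1-\gamma$. The *Cramér sequence* is $\mu_n=\mu_{\Lambda(n)}\circ\mathfrak m_{\Lambda(n)}^{-1}$. Its *entropy* and *pressure* are, for $x\in X$ and $\lambda\in X^*$, $$s(x)=\inf_{C\in\mathcal C_0}\liminf_{n\to\infty}\frac1{|\Lambda(n)|}\log\mu_n(x+C),\qquad p(\lambda)=\limsup_{n\to\infty}\frac1{|\Lambda(n)|}\log\int e^{|\Lambda(n)|\langle\lambda|x\rangle}\,d\mu_n(x),$$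 with values in $[-\infty,+\infty]$. For $D\subset X$ the property $(\mathrm{BS}_{\flat,D})$ is: for every $K\in\mathcal F$ such that $K\cap D$ is relatively compact, $$\limsup_{n\to\infty}\frac1{|\Lambda(n)|}\log\mu_n(K)\le\sup_{\overline K}s .$$ A *weak LDP* for $(\mu_n)$ means $(\mathrm{BS}_{\flat,X})$ together with the lower bound $\liminf_n\frac1{|\Lambda(n)|}\log\mu_n(A)\ge\sup_{\mathring A}s$ for all $A\in\mathcal F$. If $D$ is convex and the system is carried by $D^{\mathbb Z^d}$, let $\mu_n|_D$ be the trace of $\mu_n$ on $D$, i.e. the probability measure $A\cap D\mapsto\mu_n(A)$ on the trace $\sigma$-algebra of $\mathcal F$ on $D$. Its entropy and weak LDP are defined in the same way in the topological subspace $D$, with the neighbourhoods $(x+C)\cap D$, $C\in\mathcal C_0$, of $x\in D$. **Theorem.** Let $(X,\mathcal C_0,\mathcal F,\tau)$ be a measurable locally convex space, $d\ge1$, $D\subset X$ convex, $(\mu_\Lambda)$ a compatible translation-invariant system on $X^{\mathbb Z^d}$ carried by $D^{\mathbb Z^d}$, and $(\mu_n)_{n\ge1}$ its Cramér sequence. If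 $(\mu_\Lambda)$ is lower asymptotically decoupled and locally controlled, then: 1. $(\mu_n)$ satisfies $(\mathrm{BS}_{\flat,D})$; in particular $(\mu_n)$ and $(\mu_n|_D)$ satisfy a weak LDP; 2. for every $\lambda\in X^*$ the pressure is a limit, $p(\lambda)=\lim_{n\to\infty}\frac1{|\Lambda(n)|}\log\int e^{|\Lambda(n)|\langle\lambda|x\rangle}\,d\mu_n(x)$ in $[-\infty,+\infty]$, and $p(\lambda)-s(x)\ge\langle\lambda|x\rangle$ for all $\lambda\in X^*$, $x\in X$; 3. if moreover $(\mu_\Lambda)$ is locally convex-tight on $D$, then $s(x)=\inf_{\lambda\in X^*}\big(p(\lambda)-\langle\lambda|x\rangle\big)$ for all $x\in X$. -/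

import Mathlib

open MeasureTheory Filter Topology Set
open scoped Pointwise ENNReal NNReal ProbabilityTheory

noncomputable section

namespace CramerField

/-! ### Internal convex sets and measurable locally convex spaces -/

section Space

variable {X : Type*} [AddCommGroup X] [Module ℝ X]

/-- The gauge `M_C x = inf {t ≥ 0 | x ∈ t C}`, with values in `[0, ∞]`. -/
def minkowski (C : Set X) (x : X) : ℝ≥0∞ :=
  ⨅ (t : ℝ≥0) (_ : x ∈ (t : ℝ) • C), (t : ℝ≥0∞)

/-- A convex set is internal if its gauge is finite everywhere and it is the open unit ball
of its gauge. -/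
structure IsInternal (C : Set X) : Prop where
  convex : Convex ℝ C
  finite : ∀ x, minkowski C x < ⊤
  eq_ball : C = {x | minkowski C x < 1}

variable (X) in
/-- The σ-algebra is stable under dilations (of nonzero ratio) and under translations. -/
structure IsStableAlgebra [MeasurableSpace X] : Prop where
  dilation : ∀ (a : ℝ) (A : Set X), a ≠ 0 → MeasurableSet A → MeasurableSet (a • A)
  translation : ∀ (x : X) (A : Set X), MeasurableSet A → MeasurableSet (x +ᵥ A)

/-- The set of all measurable internal convex sets. -/
def internalSets (X : Type*) [AddCommGroup X] [Module ℝ X] [MeasurableSpace X] : Set (Set X) :=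
  {C | IsInternal C ∧ MeasurableSet C}

/-- `(X, C₀, 𝓕, τ)` is a measurable locally convex space. The field `basis` says that `τ` is
the (unique) vector space topology for which `C₀` is a fundamental system of neighbourhoods
of `0`. -/
structure IsMeasurableLCS [MeasurableSpace X] [TopologicalSpace X] (C₀ : Set (Set X)) : Prop where
  stable : IsStableAlgebra X
  internal : ∀ C ∈ C₀, C ∈ internalSets X
  symmetric : ∀ C ∈ C₀, -C = C
  inter_mem : ∀ C ∈ C₀, ∀ C' ∈ C₀, C ∩ C' ∈ C₀
  dilation_mem : ∀ (a : ℝ), a ≠ 0 → ∀ C ∈ C₀, a • C ∈ C₀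
  sInter_eq : ⋂₀ C₀ = {0}
  topAddGroup : IsTopologicalAddGroup X
  continuousSMul : ContinuousSMul ℝ X
  basis : (𝓝 (0 : X)).HasBasis (fun C => C ∈ C₀) id
  dual_measurable : ∀ l : X →L[ℝ] ℝ, Measurable l

end Space

/-! ### Boxes and configurations -/

/-- A box of `ℤ^d`: the translate by `corner` of `[0, size[^d`, with `size ≥ 1`. -/
structure Box (d : ℕ) where
  corner : Fin d → ℤ
  size : ℕ+

namespace Box

variable {d : ℕ}

/-- The sites of the box. -/
def sites (L : Box d) : Finset (Fin d → ℤ) :=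
  Fintype.piFinset fun i => Finset.Ico (L.corner i) (L.corner i + (L.size : ℕ))

/-- The translated box `L + z`. -/
def shift (L : Box d) (z : Fin d → ℤ) : Box d := ⟨L.corner + z, L.size⟩

/-- The box `Λ(n) = [0, n[^d`. -/
def std (d : ℕ) (n : ℕ+) : Box d := ⟨0, n⟩

end Box

/-- Configurations `σ : ℤ^d → X`. -/
abbrev Config (d : ℕ) (X : Type*) := (Fin d → ℤ) → X

section Fields

variable {X : Type*} [AddCommGroup X] [Module ℝ X] {d : ℕ}

/-- The empirical mean over a box. -/
def mean (L : Box d) (σ : Config d X) : X :=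
  (L.sites.card : ℝ)⁻¹ • ∑ z ∈ L.sites, σ z

/-- The σ-algebra `𝓕_S` on configurations, initial for the empirical means over the boxes
included in `S`. -/
@[reducible] def algebra (X : Type*) [AddCommGroup X] [Module ℝ X] [mX : MeasurableSpace X] {d : ℕ}
    (S : Finset (Fin d → ℤ)) : MeasurableSpace (Config d X) :=
  ⨆ (L : Box d) (_ : L.sites ⊆ S), MeasurableSpace.comap (mean L) mX

/-- The translated event `A + z = {σ(· - z) | σ ∈ A}`. -/
def shiftEvent (A : Set (Config d X)) (z : Fin d → ℤ) : Set (Config d X) :=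
  (fun (σ : Config d X) (w : Fin d → ℤ) => σ (w - z)) '' A

/-- A compatible system of translation invariant probability measures on `X^(ℤ^d)`:
for each box `L`, a probability measure on the σ-algebra `𝓕_L`. -/
structure InvSystem (d : ℕ) (X : Type*) [AddCommGroup X] [Module ℝ X] [MeasurableSpace X] where
  law : (L : Box d) → @Measure (Config d X) (algebra X L.sites)
  prob : ∀ L, law L univ = 1
  comp : ∀ L₁ L₂ : Box d, L₁.sites ⊆ L₂.sites → ∀ A : Set (Config d X),
    MeasurableSet[algebra X L₁.sites] A → law L₂ A = law L₁ A
  inv : ∀ (L : Box d) (z : Fin d → ℤ) (A : Set (Config d X)),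
    MeasurableSet[algebra X L.sites] A → law (L.shift z) (shiftEvent A z) = law L A

variable [MeasurableSpace X]

namespace InvSystem

/-- The system is carried by a set `E` of configurations. -/
def CarriedBy (μ : InvSystem d X) (E : Set (Config d X)) : Prop :=
  ∀ (L : Box d) (A B : Set (Config d X)), MeasurableSet[algebra X L.sites] A →
    MeasurableSet[algebra X L.sites] B → A ∩ E = B ∩ E → μ.law L A = μ.law L B

/-- Lower asymptotic decoupling. The probabilities of `A`, `B` and `A ∩ B` are computed in any
box `L` that contains `Λ(m)` and `S`; the metric on `ℤ^d` is that of the sup norm. -/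
def LowerDecoupled (μ : InvSystem d X) : Prop :=
  ∃ g c : ℕ+ → ℝ,
    (∀ m, 0 ≤ g m) ∧ (∀ m, 0 ≤ c m) ∧
    Tendsto (fun m : ℕ+ => g m / ((m : ℕ) : ℝ)) atTop (𝓝 0) ∧
    Tendsto (fun m : ℕ+ => c m / ((Box.std d m).sites.card : ℝ)) atTop (𝓝 0) ∧
    ∀ (m : ℕ+) (S : Finset (Fin d → ℤ)) (A B : Set (Config d X)),
      MeasurableSet[algebra X (Box.std d m).sites] A → MeasurableSet[algebra X S] B →
      (∀ z ∈ S, ∀ w ∈ (Box.std d m).sites, g m < dist z w) →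
      ∀ L : Box d, (Box.std d m).sites ⊆ L.sites → S ⊆ L.sites →
        ENNReal.ofReal (Real.exp (-c m)) * μ.law L A * μ.law L B ≤ μ.law L (A ∩ B)

/-- The conditional probability `P(σ(0) ∈ A | 𝓕_{L \ {0}})`, for a box `L` containing `0`. -/
def condProbZero (μ : InvSystem d X) (L : Box d) (A : Set X) : Config d X → ℝ :=
  (μ.law L)⟦{σ : Config d X | σ 0 ∈ A}|algebra X (L.sites.erase 0)⟧

/-- Local control. -/
def LocallyControlled (μ : InvSystem d X) : Prop :=
  ∃ t α : Set X → ℝ, ∀ C ∈ internalSets X, 0 < t C ∧ 0 < α C ∧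
    ∀ L : Box d, 0 ∈ L.sites → ∀ᵐ σ ∂(μ.law L), α C ≤ μ.condProbZero L (t C • C) σ

/-- Local convex tightness on `D`. -/
def LocallyConvexTight [TopologicalSpace X] (μ : InvSystem d X) (D : Set X) : Prop :=
  ∀ γ : ℝ, 0 < γ → ∃ K : Set X, MeasurableSet K ∧ Convex ℝ (K ∩ D) ∧
    IsCompact (closure (K ∩ D)) ∧
    ∀ L : Box d, 0 ∈ L.sites → ∀ᵐ σ ∂(μ.law L), 1 - γ ≤ μ.condProbZero L K σ

/-- The Cramér sequence: the law of the empirical mean over `Λ(n)`. -/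
def cramer (μ : InvSystem d X) (n : ℕ+) : Measure X :=
  @Measure.map (Config d X) X (algebra X (Box.std d n).sites) _ (mean (Box.std d n))
    (μ.law (Box.std d n))

end InvSystem

end Fields

/-! ### Large deviations -/

section LargeDeviations

/-- The trace of a measure on a (possibly non-measurable) subset `D`, on the trace σ-algebra.
If `ν` is carried by `D` its value at `A ∩ D` is `ν A`, for every measurable `A`. -/
def traceMeasure {E : Type*} [MeasurableSpace E] (ν : Measure E) (D : Set E) : Measure D :=
  (OuterMeasure.comap (Subtype.val : D → E) ν.toOuterMeasure).toMeasure <| by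
    rintro _ ⟨B, hB, rfl⟩ t
    simp only [OuterMeasure.comap_apply, Measure.coe_toOuterMeasure]
    rw [← measure_inter_add_sdiff (μ := ν) (Subtype.val '' t) hB]
    congr 2 <;> ext x <;> simp <;> tauto

variable {E : Type*} [MeasurableSpace E]

/-- `(1 / |Λ(n)|) log ν_n(A)`, with values in `[-∞, +∞]`. -/
def logRate (d : ℕ) (ν : ℕ+ → Measure E) (A : Set E) (n : ℕ+) : EReal :=
  ENNReal.log (ν n A) / ((Box.std d n).sites.card : EReal)

/-- The (lower) entropy of a sequence of measures, with respect to a family `N x` of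
neighbourhoods of each point `x`. -/
def entropy (d : ℕ) (N : E → Set (Set E)) (ν : ℕ+ → Measure E) (x : E) : EReal :=
  ⨅ C ∈ N x, liminf (logRate d ν C) atTop

/-- The lower bound: `liminf (1/|Λ(n)|) log ν_n(A) ≥ sup s` over the interior of `A`. -/
def LowerBound [TopologicalSpace E] (d : ℕ) (ν : ℕ+ → Measure E) (s : E → EReal) : Prop :=
  ∀ A : Set E, MeasurableSet A → ⨆ x ∈ interior A, s x ≤ liminf (logRate d ν A) atTop

/-- The weak upper bound relative to `D`: the upper bound for the measurable sets `K` such that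
`K ∩ D` is relatively compact. -/
def WeakUpperBound [TopologicalSpace E] (d : ℕ) (D : Set E) (ν : ℕ+ → Measure E)
    (s : E → EReal) : Prop :=
  ∀ K : Set E, MeasurableSet K → IsCompact (closure (K ∩ D)) →
    limsup (logRate d ν K) atTop ≤ ⨆ x ∈ closure K, s x

/-- The weak large deviation principle with entropy `s`. -/
def WeakLDP [TopologicalSpace E] (d : ℕ) (ν : ℕ+ → Measure E) (s : E → EReal) : Prop :=
  LowerBound d ν s ∧ WeakUpperBound d univ ν s

variable {X : Type*} [AddCommGroup X]

/-- The neighbourhoods `x + C`, `C ∈ C₀`, of `x`. -/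
def nbhds (C₀ : Set (Set X)) (x : X) : Set (Set X) := {U | ∃ C ∈ C₀, U = x +ᵥ C}

/-- The neighbourhoods `(x + C) ∩ D`, `C ∈ C₀`, of `x` in the subspace `D`. -/
def nbhdsIn (C₀ : Set (Set X)) (D : Set X) (x : D) : Set (Set D) :=
  {U | ∃ V ∈ nbhds C₀ (x : X), U = Subtype.val ⁻¹' V}

variable [Module ℝ X] [MeasurableSpace X] [TopologicalSpace X]

/-- `(1 / |Λ(n)|) log ∫ exp(|Λ(n)| ⟨l|x⟩) dν_n(x)`, with values in `[-∞, +∞]`. -/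
def logLaplace (d : ℕ) (ν : ℕ+ → Measure X) (l : X →L[ℝ] ℝ) (n : ℕ+) : EReal :=
  ENNReal.log (∫⁻ x, ENNReal.ofReal (Real.exp (((Box.std d n).sites.card : ℝ) * l x)) ∂(ν n)) /
    ((Box.std d n).sites.card : EReal)

/-- The pressure. -/
def pressure (d : ℕ) (ν : ℕ+ → Measure X) (l : X →L[ℝ] ℝ) : EReal :=
  limsup (logLaplace d ν l) atTop

end LargeDeviations

end CramerField

end

namespace CramerField

/-! ### Comparison of measures on sub-σ-algebras -/

section Comparison

variable {Ω : Type*} {m m₁ m₂ m₀ : MeasurableSpace Ω}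

lemma mul_lintegral_le_of_forall_measure_le (hm : m ≤ m₀) (P Q : @Measure Ω m₀) (κ : ℝ≥0∞)
    (h : ∀ B, MeasurableSet[m] B → κ * P B ≤ Q B) (f : Ω → ℝ≥0∞) (hf : Measurable[m] f) :
    κ * ∫⁻ x, f x ∂P ≤ ∫⁻ x, f x ∂Q := by
  rw [← lintegral_trim hm hf, ← lintegral_trim hm hf, ← smul_eq_mul,
    ← lintegral_smul_measure]
  refine lintegral_mono' (Measure.le_iff.2 fun s hs => ?_) le_rfl
  rw [Measure.smul_apply, trim_measurableSet_eq hm hs, trim_measurableSet_eq hm hs]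
  exact h s hs

lemma mul_lintegral_le_setLIntegral (hm : m ≤ m₀) (P : @Measure Ω m₀) (κ : ℝ≥0∞) (G : Set Ω)
    (h : ∀ B, MeasurableSet[m] B → κ * P B ≤ P (B ∩ G)) (f : Ω → ℝ≥0∞) (hf : Measurable[m] f) :
    κ * ∫⁻ x, f x ∂P ≤ ∫⁻ x in G, f x ∂P :=
  mul_lintegral_le_of_forall_measure_le hm P (P.restrict G) κ
    (fun B hB => by rw [Measure.restrict_apply (hm _ hB)]; exact h B hB) f hf

lemma mul_lintegral_mul_lintegral_le (hm₁ : m₁ ≤ m₀) (hm₂ : m₂ ≤ m₀) (P : @Measure Ω m₀)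
    (κ : ℝ≥0∞)
    (h : ∀ A B, MeasurableSet[m₁] A → MeasurableSet[m₂] B → κ * P A * P B ≤ P (A ∩ B))
    (f g : Ω → ℝ≥0∞) (hf : Measurable[m₁] f) (hg : Measurable[m₂] g) :
    κ * (∫⁻ x, f x ∂P) * (∫⁻ x, g x ∂P) ≤ ∫⁻ x, f x * g x ∂P := by
  have hf' : Measurable[m₀] f := hf.mono hm₁ le_rfl
  have hg' : Measurable[m₀] g := hg.mono hm₂ le_rfl
  have key : ∀ A, MeasurableSet[m₁] A →
      (κ * ∫⁻ x, g x ∂P) * P A ≤ (P.withDensity g) A := fun A hA => by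
    rw [withDensity_apply _ (hm₁ _ hA)]
    have := mul_lintegral_le_setLIntegral hm₂ P (κ * P A) A
      (fun B hB => by rw [inter_comm]; exact h A B hA hB) g hg
    calc _ = _ := by ring
      _ ≤ _ := this
  have := mul_lintegral_le_of_forall_measure_le hm₁ P _ _ key f hf
  rw [lintegral_withDensity_eq_lintegral_mul _ hg' hf'] at this
  calc _ = _ := by ring
    _ ≤ _ := this
    _ = _ := by simp [mul_comm]

end Comparison

/-! ### Exponential rates -/

section Rates

lemma coe_le_log_div_iff {v : ℕ} (hv : 0 < v) (a : ℝ) (w : ℝ≥0∞) :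
    (a : EReal) ≤ ENNReal.log w / (v : EReal) ↔ ENNReal.ofReal (Real.exp (a * v)) ≤ w := by
  have h1 : (0 : EReal) < (v : EReal) := by exact_mod_cast hv
  rw [EReal.le_div_iff_mul_le h1 (EReal.natCast_ne_top v), ← ENNReal.log_le_log_iff,
    ENNReal.log_ofReal_of_pos (Real.exp_pos _), Real.log_exp]
  norm_cast

lemma log_div_le_coe_iff {v : ℕ} (hv : 0 < v) (a : ℝ) (w : ℝ≥0∞) :
    ENNReal.log w / (v : EReal) ≤ a ↔ w ≤ ENNReal.ofReal (Real.exp (a * v)) := by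
  have h1 : (0 : EReal) < (v : EReal) := by exact_mod_cast hv
  rw [EReal.div_le_iff_le_mul h1 (EReal.natCast_ne_top v), ← ENNReal.log_le_log_iff,
    ENNReal.log_ofReal_of_pos (Real.exp_pos _), Real.log_exp, mul_comm]
  norm_cast

lemma le_of_forall_coe_lt {a b : EReal} (h : ∀ r : ℝ, (r : EReal) < a → (r : EReal) ≤ b) :
    a ≤ b := by
  refine le_of_forall_lt fun c hc => ?_
  obtain ⟨r, h1, h2⟩ := EReal.lt_iff_exists_real_btwn.1 hc
  exact h1.trans_le (h r h2)

lemma le_of_forall_lt_coe {a b : EReal} (h : ∀ r : ℝ, b < r → a ≤ r) : a ≤ b := by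
  refine le_of_forall_gt fun c hc => ?_
  obtain ⟨r, h1, h2⟩ := EReal.lt_iff_exists_real_btwn.1 hc
  exact (h r h1).trans_lt h2

/-- A tiling argument: `k ^ d` cells of side `m`, repeated with period `q m`, fill most of a box
of side `N` when `m` and then `N` are large. -/
lemma exists_even_tiling {d : ℕ} {q : ℕ+ → ℕ} (hq : ∀ m : ℕ+, (m : ℕ) ≤ q m)
    (hq' : Tendsto (fun m : ℕ+ => ((m : ℕ) : ℝ) / q m) atTop (𝓝 1)) {δ : ℝ} (hδ : 0 < δ) :
    ∀ᶠ m : ℕ+ in atTop, ∀ᶠ N : ℕ+ in atTop, ∃ k : ℕ, 0 < k ∧ Even k ∧ k * q m ≤ N ∧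
      (1 - δ) * ((N : ℕ) : ℝ) ^ d ≤ ((k : ℝ) * ((m : ℕ) : ℝ)) ^ d := by
  obtain ⟨η, hη0, hη1, hη⟩ : ∃ η : ℝ, 0 < η ∧ η ≤ 1 ∧ 1 - δ ≤ (1 - η) ^ d := by
    refine ⟨min 1 (δ / (d + 1)), by positivity, min_le_left _ _, ?_⟩
    have h1 : min 1 (δ / (d + 1)) ≤ δ / (d + 1) := min_le_right _ _
    have h2 : min 1 (δ / (d + 1)) ≤ 1 := min_le_left _ _
    have h0 : 0 < min 1 (δ / (d + 1)) := by positivity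
    have h3 := one_add_mul_le_pow (a := -min 1 (δ / (d + 1))) (by linarith) d
    rw [le_div_iff₀ (by positivity)] at h1
    have : (1 : ℝ) + -min 1 (δ / (d + 1)) = 1 - min 1 (δ / (d + 1)) := by ring
    rw [this] at h3
    nlinarith
  have h1 : ∀ᶠ m : ℕ+ in atTop, 1 - η / 2 < ((m : ℕ) : ℝ) / q m :=
    hq'.eventually (lt_mem_nhds (by linarith))
  filter_upwards [h1] with m hm
  have hm0 : (0 : ℝ) < ((m : ℕ) : ℝ) := by exact_mod_cast m.pos
  have hq0 : 0 < q m := m.pos.trans_le (hq m)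
  have hq0' : (0 : ℝ) < q m := by exact_mod_cast hq0
  rw [lt_div_iff₀ hq0'] at hm
  obtain ⟨N₀, hN₀⟩ := exists_nat_gt (max (2 * (q m : ℝ)) (4 * m / η))
  filter_upwards [eventually_ge_atTop (⟨N₀ + 1, N₀.succ_pos⟩ : ℕ+)] with N hN
  have hN' : N₀ + 1 ≤ (N : ℕ) := hN
  have hNR : (N₀ : ℝ) ≤ ((N : ℕ) : ℝ) := by exact_mod_cast (by omega : N₀ ≤ (N : ℕ))
  have hN1 : 2 * (q m : ℝ) ≤ ((N : ℕ) : ℝ) := (le_max_left _ _).trans (hN₀.le.trans hNR)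
  have hN2 : 4 * m / η ≤ ((N : ℕ) : ℝ) := (le_max_right _ _).trans (hN₀.le.trans hNR)
  have hN1' : 2 * q m ≤ N := by exact_mod_cast hN1
  rw [div_le_iff₀ hη0] at hN2
  set j := (N : ℕ) / (2 * q m) with hj
  have hj1 : j * (2 * q m) ≤ N := Nat.div_mul_le_self _ _
  have hj2 : (N : ℕ) < (j + 1) * (2 * q m) := Nat.lt_mul_of_div_lt (Nat.lt_succ_self _) (by omega)
  refine ⟨2 * j, ?_, even_two_mul j, by nlinarith, ?_⟩
  · have : 0 < j := Nat.div_pos hN1' (by omega)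
    omega
  · have hj2' : ((N : ℕ) : ℝ) < ((j : ℝ) + 1) * (2 * q m) := by exact_mod_cast hj2
    have key : (1 - η) * ((N : ℕ) : ℝ) ≤ ((2 * j : ℕ) : ℝ) * ((m : ℕ) : ℝ) := by
      push_cast
      have hNpos : (0 : ℝ) < ((N : ℕ) : ℝ) := by exact_mod_cast N.pos
      by_contra hcon
      push Not at hcon
      have e1 : ((N : ℕ) : ℝ) * m < (2 * j * m + 2 * m) * q m := by nlinarith
      have e2 : ((N : ℕ) : ℝ) * m < ((1 - η) * N + η / 2 * N) * q m := by nlinarith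
      nlinarith
    have h1η : 0 ≤ 1 - η := by linarith
    calc (1 - δ) * ((N : ℕ) : ℝ) ^ d ≤ (1 - η) ^ d * ((N : ℕ) : ℝ) ^ d := by gcongr
      _ = ((1 - η) * ((N : ℕ) : ℝ)) ^ d := by rw [mul_pow]
      _ ≤ _ := by gcongr

/-- Almost supermultiplicative sequences: the upper rate of `u` is at most the lower rate of
`w`. -/
lemma limsup_rate_le_liminf_rate {d : ℕ} {c : ℕ+ → ℝ}
    (hc : Tendsto (fun m : ℕ+ => c m / (((m : ℕ) ^ d : ℕ) : ℝ)) atTop (𝓝 0)) {q : ℕ+ → ℕ}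
    (hq : ∀ m : ℕ+, (m : ℕ) ≤ q m)
    (hq' : Tendsto (fun m : ℕ+ => ((m : ℕ) : ℝ) / q m) atTop (𝓝 1)) (u w : ℕ+ → ℝ≥0∞) {κ δ : ℝ}
    (hκ : 0 < κ) (hδ : 0 < δ)
    (h : ∀ m : ℕ+, ∀ᶠ N : ℕ+ in atTop, ∀ k : ℕ, 0 < k → Even k → k * q m ≤ N →
      (1 - δ) * ((N : ℕ) : ℝ) ^ d ≤ ((k : ℝ) * ((m : ℕ) : ℝ)) ^ d →
      (ENNReal.ofReal (Real.exp (-c m)) * u m) ^ k ^ d *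
        ENNReal.ofReal κ ^ ((N : ℕ) ^ d - (k * m) ^ d) ≤ w N) :
    limsup (fun n : ℕ+ => ENNReal.log (u n) / (((n : ℕ) ^ d : ℕ) : EReal)) atTop ≤
      liminf (fun n : ℕ+ => ENNReal.log (w n) / (((n : ℕ) ^ d : ℕ) : EReal)) atTop := by
  refine le_of_forall_coe_lt fun a ha => le_of_forall_coe_lt fun b hb => ?_
  have hba : b < a := by exact_mod_cast hb
  have hfreq := frequently_lt_of_lt_limsup (by isBoundedDefault) ha
  set M : ℝ := |a| + |Real.log κ| + 1 with hM
  have hM0 : 0 < M := by positivity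
  set δ' := min δ ((a - b) / (2 * M)) with hδ'
  have hab : 0 < a - b := by linarith
  have hδ'0 : 0 < δ' := by positivity
  have hc' : ∀ᶠ m : ℕ+ in atTop, c m / (((m : ℕ) ^ d : ℕ) : ℝ) < (a - b) / 2 :=
    hc.eventually (gt_mem_nhds (by positivity))
  obtain ⟨m, hma, hmc, hmt⟩ := (hfreq.and_eventually
    (hc'.and (exists_even_tiling (d := d) hq hq' hδ'0))).exists
  refine le_liminf_of_le (by isBoundedDefault) ?_
  filter_upwards [hmt, h m] with N hN hNw
  obtain ⟨k, hk0, hk2, hkq, hkδ⟩ := hN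
  have hvN : 0 < (N : ℕ) ^ d := by have := N.pos; positivity
  have hvm : 0 < (m : ℕ) ^ d := by have := m.pos; positivity
  rw [coe_le_log_div_iff hvN]
  have hNR : (0 : ℝ) < ((N : ℕ) : ℝ) ^ d := by exact_mod_cast hvN
  have hmR : (0 : ℝ) < ((m : ℕ) : ℝ) ^ d := by exact_mod_cast hvm
  refine le_trans ?_ (hNw k hk0 hk2 hkq (le_trans ?_ hkδ))
  swap
  · have : δ' ≤ δ := min_le_left _ _
    gcongr
  have hua : ENNReal.ofReal (Real.exp (a * ((m : ℕ) ^ d : ℕ))) ≤ u m :=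
    (coe_le_log_div_iff hvm a _).1 hma.le
  have hkm : k * m ≤ N := (Nat.mul_le_mul_left k (hq m)).trans hkq
  have hkmd : (k * m) ^ d ≤ (N : ℕ) ^ d := Nat.pow_le_pow_left hkm d
  have hkmR : ((k : ℝ) * ((m : ℕ) : ℝ)) ^ d ≤ ((N : ℕ) : ℝ) ^ d := by exact_mod_cast hkmd
  calc ENNReal.ofReal (Real.exp (b * ((N : ℕ) ^ d : ℕ)))
      ≤ ENNReal.ofReal ((Real.exp (-c m) * Real.exp (a * ((m : ℕ) ^ d : ℕ))) ^ k ^ d *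
        κ ^ ((N : ℕ) ^ d - (k * m) ^ d)) := by
        apply ENNReal.ofReal_le_ofReal
        rw [← Real.exp_log hκ, ← Real.exp_add, ← Real.exp_nat_mul, ← Real.exp_nat_mul,
          ← Real.exp_add, Real.exp_le_exp, Nat.cast_sub hkmd]
        push_cast
        rw [div_lt_iff₀ (by exact_mod_cast hvm)] at hmc
        push_cast at hmc
        set V := ((N : ℕ) : ℝ) ^ d
        set R := ((k : ℝ) * ((m : ℕ) : ℝ)) ^ d with hR
        have hRV : R ≤ V := hkmR
        have hkR : (k : ℝ) ^ d * ((m : ℕ) : ℝ) ^ d = R := by rw [hR, mul_pow]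
        have hk0' : (0 : ℝ) ≤ (k : ℝ) ^ d := by positivity
        have e1 : (k : ℝ) ^ d * c m ≤ (a - b) / 2 * R := by
          rw [← hkR]
          calc (k : ℝ) ^ d * c m ≤ (k : ℝ) ^ d * ((a - b) / 2 * ((m : ℕ) : ℝ) ^ d) := by gcongr
            _ = _ := by ring
        have e2 : V - R ≤ (a - b) / (2 * M) * V := by
          have : δ' ≤ (a - b) / (2 * M) := min_le_right _ _
          have := mul_le_mul_of_nonneg_right this hNR.le
          linarith
        have e3 : M * (V - R) ≤ (a - b) / 2 * V := by
          calc M * (V - R) ≤ M * ((a - b) / (2 * M) * V) := by gcongr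
            _ = _ := by field_simp
        have e4 : -((|a| + |Real.log κ|) * (V - R)) ≤ (V - R) * (Real.log κ - a) := by
          have := neg_abs_le (Real.log κ)
          have := le_abs_self a
          nlinarith
        have e5 : (k : ℝ) ^ d * (-c m + a * ((m : ℕ) : ℝ) ^ d) = a * R - (k : ℝ) ^ d * c m := by
          rw [← hkR]; ring
        have e6 : (a - b) / 2 * R ≤ (a - b) / 2 * V := by gcongr
        have e7 : 0 ≤ V - R := by linarith
        rw [e5]
        rw [hM] at e3
        nlinarith
    _ = (ENNReal.ofReal (Real.exp (-c m)) * ENNReal.ofReal (Real.exp (a * ((m : ℕ) ^ d : ℕ)))) ^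
          k ^ d * ENNReal.ofReal κ ^ ((N : ℕ) ^ d - (k * m) ^ d) := by
        rw [ENNReal.ofReal_mul (by positivity), ENNReal.ofReal_pow (by positivity),
          ENNReal.ofReal_pow hκ.le, ENNReal.ofReal_mul (by positivity)]
    _ ≤ _ := by gcongr

end Rates

/-! ### Boxes, empirical means and translations -/

namespace Box

variable {d : ℕ}

lemma mem_sites {L : Box d} {z : Fin d → ℤ} :
    z ∈ L.sites ↔ ∀ i, L.corner i ≤ z i ∧ z i < L.corner i + (L.size : ℕ) := by
  simp [sites, Fintype.mem_piFinset]

lemma card_sites (L : Box d) : L.sites.card = (L.size : ℕ) ^ d := by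
  simp [sites, Fintype.card_piFinset]

lemma card_std (n : ℕ+) : (std d n).sites.card = (n : ℕ) ^ d := card_sites _

lemma mem_sites_shift {L : Box d} {z w : Fin d → ℤ} :
    z ∈ (L.shift w).sites ↔ z - w ∈ L.sites := by
  simp only [mem_sites, shift, Pi.add_apply, Pi.sub_apply]
  exact forall_congr' fun i => by constructor <;> rintro ⟨h1, h2⟩ <;> constructor <;> omega

lemma sites_shift (L : Box d) (w : Fin d → ℤ) :
    (L.shift w).sites = L.sites.map (addRightEmbedding w) := by
  ext z
  simp only [mem_sites_shift, Finset.mem_map, addRightEmbedding_apply]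
  exact ⟨fun h => ⟨_, h, sub_add_cancel _ _⟩, by rintro ⟨y, hy, rfl⟩; simpa using hy⟩

lemma card_sites_pos (L : Box d) : 0 < L.sites.card := by
  rw [card_sites]
  exact pow_pos L.size.pos d

end Box

section Algebra

lemma mem_shiftEvent {X : Type*} {d : ℕ} {A : Set (Config d X)} {z : Fin d → ℤ} {σ : Config d X} :
    σ ∈ shiftEvent A z ↔ (fun w => σ (w + z)) ∈ A := by
  constructor
  · rintro ⟨τ, hτ, rfl⟩
    simpa using hτ
  · exact fun h => ⟨_, h, by simp⟩

lemma shiftEvent_inter {X : Type*} {d : ℕ} (A B : Set (Config d X)) (z : Fin d → ℤ) :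
    shiftEvent (A ∩ B) z = shiftEvent A z ∩ shiftEvent B z := by
  ext σ
  simp [mem_shiftEvent]

variable {X : Type*} [AddCommGroup X] [Module ℝ X] {d : ℕ}

lemma mean_shift (L : Box d) (z : Fin d → ℤ) (σ : Config d X) :
    mean (L.shift z) σ = mean L (fun w => σ (w + z)) := by
  simp [mean, Box.sites_shift]

lemma card_smul_mean (L : Box d) (σ : Config d X) :
    (L.sites.card : ℝ) • mean L σ = ∑ z ∈ L.sites, σ z := by
  have : (L.sites.card : ℝ) ≠ 0 := by exact_mod_cast L.card_sites_pos.ne'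
  rw [mean, smul_inv_smul₀ this]

lemma mean_mem {D : Set X} (hD : Convex ℝ D) (L : Box d) {σ : Config d X}
    (h : ∀ z ∈ L.sites, σ z ∈ D) : mean L σ ∈ D := by
  have : (L.sites.card : ℝ) ≠ 0 := by exact_mod_cast L.card_sites_pos.ne'
  rw [mean, Finset.smul_sum]
  refine hD.sum_mem (fun _ _ => by positivity) ?_ h
  rw [Finset.sum_const, nsmul_eq_mul, mul_inv_cancel₀ this]

variable [MeasurableSpace X]

lemma algebra_mono {S T : Finset (Fin d → ℤ)} (h : S ⊆ T) : algebra X S ≤ algebra X T :=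
  iSup₂_le fun L hL => le_iSup₂_of_le L (hL.trans h) le_rfl

lemma measurable_mean {L : Box d} {S : Finset (Fin d → ℤ)} (h : L.sites ⊆ S) :
    Measurable[algebra X S] (mean L : Config d X → X) :=
  measurable_iff_comap_le.2 (le_iSup₂_of_le (f := fun (L : Box d) (_ : L.sites ⊆ S) =>
    MeasurableSpace.comap (mean L) _) L h le_rfl)

lemma measurable_site {z : Fin d → ℤ} {S : Finset (Fin d → ℤ)} (h : z ∈ S) :
    Measurable[algebra X S] (fun σ : Config d X => σ z) := by
  have hs : (⟨z, 1⟩ : Box d).sites = {z} := by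
    ext w
    simp only [Box.mem_sites, Finset.mem_singleton, funext_iff, PNat.one_coe, Nat.cast_one]
    exact forall_congr' fun i => by omega
  have : (mean ⟨z, 1⟩ : Config d X → X) = fun σ => σ z := by
    funext σ
    simp [mean, hs]
  rw [← this]
  exact measurable_mean (by simpa [hs] using h)

lemma measurableSet_shiftEvent {S T : Finset (Fin d → ℤ)} {z : Fin d → ℤ}
    (h : ∀ w ∈ S, w + z ∈ T) {A : Set (Config d X)} (hA : MeasurableSet[algebra X S] A) :
    MeasurableSet[algebra X T] (shiftEvent A z) := by
  have key : @Measurable _ _ (algebra X T) (algebra X S)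
      (fun (σ : Config d X) (w : Fin d → ℤ) => σ (w + z)) := by
    rw [measurable_iff_comap_le, algebra, MeasurableSpace.comap_iSup]
    refine iSup_le fun L => ?_
    rw [MeasurableSpace.comap_iSup]
    refine iSup_le fun hL => ?_
    rw [MeasurableSpace.comap_comp, ← measurable_iff_comap_le]
    have : (mean L ∘ fun (σ : Config d X) (w : Fin d → ℤ) => σ (w + z)) = mean (L.shift z) :=
      funext fun σ => (mean_shift L z σ).symm
    rw [this]
    refine measurable_mean fun w hw => ?_
    have := h _ (hL (Box.mem_sites_shift.1 hw))
    simpa using this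
  have : shiftEvent A z = (fun (σ : Config d X) (w : Fin d → ℤ) => σ (w + z)) ⁻¹' A :=
    Set.ext fun σ => mem_shiftEvent
  rw [this]
  exact key hA

namespace InvSystem

variable (μ : InvSystem d X)

lemma isProbabilityMeasure (L : Box d) : IsProbabilityMeasure (μ.law L) := ⟨μ.prob L⟩

lemma map_mean_eq_cramer {L : Box d} {m : ℕ+} {p : Fin d → ℤ}
    (h : ((Box.std d m).shift p).sites ⊆ L.sites) :
    @Measure.map _ _ (algebra X L.sites) _ (mean ((Box.std d m).shift p)) (μ.law L) =
      μ.cramer m := by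
  refine Measure.ext fun A hA => ?_
  rw [cramer, Measure.map_apply (measurable_mean h) hA,
    Measure.map_apply (measurable_mean subset_rfl) hA,
    μ.comp _ _ h _ (measurable_mean subset_rfl hA),
    ← μ.inv (Box.std d m) p _ (measurable_mean subset_rfl hA)]
  congr 1
  ext σ
  simp [mem_shiftEvent, mean_shift]

lemma lintegral_mean_eq {L : Box d} {m : ℕ+} {p : Fin d → ℤ}
    (h : ((Box.std d m).shift p).sites ⊆ L.sites) {f : X → ℝ≥0∞} (hf : Measurable f) :
    ∫⁻ σ, f (mean ((Box.std d m).shift p) σ) ∂(μ.law L) = ∫⁻ x, f x ∂(μ.cramer m) := by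
  rw [← μ.map_mean_eq_cramer h,
    @lintegral_map _ _ (algebra X L.sites) _ _ _ _ hf (measurable_mean h)]

lemma lintegral_mean_std {m : ℕ+} {f : X → ℝ≥0∞} (hf : Measurable f) :
    ∫⁻ σ, f (mean (Box.std d m) σ) ∂(μ.law (Box.std d m)) = ∫⁻ x, f x ∂(μ.cramer m) := by
  rw [cramer, @lintegral_map _ _ (algebra X _) _ _ _ _ hf (measurable_mean subset_rfl)]

lemma cramer_apply {m : ℕ+} {A : Set X} (hA : MeasurableSet A) :
    μ.cramer m A = μ.law (Box.std d m) (mean (Box.std d m) ⁻¹' A) := by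
  rw [cramer, Measure.map_apply (measurable_mean subset_rfl) hA]

lemma isProbabilityMeasure_cramer (m : ℕ+) : IsProbabilityMeasure (μ.cramer m) :=
  ⟨by rw [μ.cramer_apply MeasurableSet.univ, preimage_univ, μ.prob]⟩

/-- The conditional probability that a site falls in `A`, given the rest of a box, is at least
`α`. -/
def SiteBound (α : ℝ) (A : Set X) : Prop :=
  ∀ L : Box d, 0 ∈ L.sites → ∀ᵐ σ ∂(μ.law L), α ≤ μ.condProbZero L A σ

variable {μ} {α : ℝ} {A : Set X}

lemma SiteBound.measure_le_of_zero (h : μ.SiteBound α A) (hA : MeasurableSet A) {L : Box d}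
    (hL : 0 ∈ L.sites) {B : Set (Config d X)}
    (hB : MeasurableSet[algebra X (L.sites.erase 0)] B) :
    ENNReal.ofReal α * μ.law L B ≤ μ.law L (B ∩ {σ | σ 0 ∈ A}) := by
  have := μ.isProbabilityMeasure L
  have hm : algebra X (L.sites.erase 0) ≤ algebra X L.sites :=
    algebra_mono (Finset.erase_subset _ _)
  have hA' : MeasurableSet[algebra X L.sites] {σ : Config d X | σ 0 ∈ A} := measurable_site hL hA
  have hint : Integrable ({σ : Config d X | σ 0 ∈ A}.indicator fun _ => (1 : ℝ)) (μ.law L) :=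
    (integrable_const (1 : ℝ)).indicator hA'
  have h1 := setIntegral_condExp (μ := μ.law L) hm hint hB
  rw [setIntegral_indicator hA', setIntegral_const, smul_eq_mul, mul_one] at h1
  have h2 : ∫ σ in B, α ∂(μ.law L) ≤ ∫ σ in B, μ.condProbZero L A σ ∂(μ.law L) :=
    setIntegral_mono_ae (integrable_const _).integrableOn integrable_condExp.integrableOn (h L hL)
  rw [setIntegral_const, smul_eq_mul] at h2
  have h3 : (μ.law L).real B * α ≤ (μ.law L).real (B ∩ {σ | σ 0 ∈ A}) := h2.trans_eq h1
  rw [← ENNReal.ofReal_toReal (measure_ne_top (μ.law L) B),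
    ← ENNReal.ofReal_toReal (measure_ne_top (μ.law L) (B ∩ _)),
    ← ENNReal.ofReal_mul' ENNReal.toReal_nonneg, mul_comm]
  exact ENNReal.ofReal_le_ofReal h3

lemma SiteBound.measure_le (h : μ.SiteBound α A) (hA : MeasurableSet A) {L : Box d}
    {z : Fin d → ℤ} (hz : z ∈ L.sites) {B : Set (Config d X)}
    (hB : MeasurableSet[algebra X (L.sites.erase z)] B) :
    ENNReal.ofReal α * μ.law L B ≤ μ.law L (B ∩ {σ | σ z ∈ A}) := by
  have hB' : MeasurableSet[algebra X L.sites] B := algebra_mono (Finset.erase_subset _ _) _ hB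
  have hA' : MeasurableSet[algebra X L.sites] {σ : Config d X | σ z ∈ A} := measurable_site hz hA
  rw [← μ.inv L (-z) B hB', ← μ.inv L (-z) _ (hB'.inter hA'), shiftEvent_inter]
  have h0 : (0 : Fin d → ℤ) ∈ (L.shift (-z)).sites := by
    rw [Box.mem_sites_shift]
    simpa using hz
  have hB0 : MeasurableSet[algebra X ((L.shift (-z)).sites.erase 0)] (shiftEvent B (-z)) := by
    refine measurableSet_shiftEvent (fun w hw => ?_) hB
    rw [Finset.mem_erase] at hw ⊢
    rw [Box.mem_sites_shift]
    exact ⟨fun h0 => hw.1 (by simpa using eq_neg_of_add_eq_zero_left h0), by simpa using hw.2⟩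
  refine (h.measure_le_of_zero hA h0 hB0).trans_eq ?_
  congr 2
  ext σ
  simp [mem_shiftEvent]

lemma SiteBound.lintegral_le (h : μ.SiteBound α A) (hA : MeasurableSet A) {L : Box d}
    {S G : Finset (Fin d → ℤ)} (hS : S ⊆ L.sites) (hG : G ⊆ L.sites) (hSG : Disjoint S G)
    {f : Config d X → ℝ≥0∞} (hf : Measurable[algebra X S] f) :
    ENNReal.ofReal α ^ G.card * ∫⁻ σ, f σ ∂(μ.law L) ≤
      ∫⁻ σ, f σ * ∏ z ∈ G, A.indicator 1 (σ z) ∂(μ.law L) := by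
  classical
  induction G using Finset.induction_on with
  | empty => simp
  | insert z G hzG ih =>
    rw [Finset.insert_subset_iff] at hG
    rw [Finset.disjoint_insert_right] at hSG
    have hfm : Measurable[algebra X (L.sites.erase z)]
        (fun σ => f σ * ∏ w ∈ G, A.indicator (1 : X → ℝ≥0∞) (σ w)) := by
      refine Measurable.mul (hf.mono (algebra_mono ?_) le_rfl)
        (Finset.measurable_fun_prod _ fun w hw => ?_)
      · exact fun w hw => Finset.mem_erase.2 ⟨fun e => hSG.1 (e ▸ hw), hS hw⟩
      · exact (measurable_one.indicator hA).comp
          (measurable_site (Finset.mem_erase.2 ⟨fun e => hzG (e ▸ hw), hG.2 hw⟩))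
    have step := mul_lintegral_le_setLIntegral (algebra_mono (Finset.erase_subset z L.sites))
      (μ.law L) (ENNReal.ofReal α) {σ | σ z ∈ A} (fun B hB => h.measure_le hA hG.1 hB) _ hfm
    have hA' : MeasurableSet[algebra X L.sites] {σ : Config d X | σ z ∈ A} :=
      measurable_site hG.1 hA
    rw [Finset.card_insert_of_notMem hzG, pow_succ']
    calc _ = ENNReal.ofReal α * (ENNReal.ofReal α ^ G.card * ∫⁻ σ, f σ ∂(μ.law L)) := by ring
      _ ≤ ENNReal.ofReal α * ∫⁻ σ, f σ * ∏ w ∈ G, A.indicator 1 (σ w) ∂(μ.law L) := by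
        gcongr
        exact ih hG.2 hSG.2
      _ ≤ _ := step
      _ = _ := by
        rw [← lintegral_indicator hA']
        refine lintegral_congr fun σ => ?_
        rw [Finset.prod_insert hzG]
        by_cases hσ : σ z ∈ A
        · simp [indicator, hσ]
        · simp [indicator, hσ]

variable (μ) in
/-- The decoupling inequality with given constants. -/
def DecoupledWith (g c : ℕ+ → ℝ) : Prop :=
  ∀ (m : ℕ+) (S : Finset (Fin d → ℤ)) (A B : Set (Config d X)),
    MeasurableSet[algebra X (Box.std d m).sites] A → MeasurableSet[algebra X S] B →
    (∀ z ∈ S, ∀ w ∈ (Box.std d m).sites, g m < dist z w) →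
    ∀ L : Box d, (Box.std d m).sites ⊆ L.sites → S ⊆ L.sites →
      ENNReal.ofReal (Real.exp (-c m)) * μ.law L A * μ.law L B ≤ μ.law L (A ∩ B)

variable {g c : ℕ+ → ℝ}

lemma DecoupledWith.shift (h : μ.DecoupledWith g c) {m : ℕ+} {S : Finset (Fin d → ℤ)}
    {p : Fin d → ℤ} {A B : Set (Config d X)}
    (hA : MeasurableSet[algebra X ((Box.std d m).shift p).sites] A)
    (hB : MeasurableSet[algebra X S] B)
    (hdist : ∀ z ∈ S, ∀ w ∈ ((Box.std d m).shift p).sites, g m < dist z w) {L : Box d}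
    (hL : ((Box.std d m).shift p).sites ⊆ L.sites) (hS : S ⊆ L.sites) :
    ENNReal.ofReal (Real.exp (-c m)) * μ.law L A * μ.law L B ≤ μ.law L (A ∩ B) := by
  have hA' : MeasurableSet[algebra X L.sites] A := algebra_mono hL _ hA
  have hB' : MeasurableSet[algebra X L.sites] B := algebra_mono hS _ hB
  rw [← μ.inv L (-p) A hA', ← μ.inv L (-p) B hB', ← μ.inv L (-p) _ (hA'.inter hB'),
    shiftEvent_inter]
  refine h m (S.map (addRightEmbedding (-p))) _ _
    (measurableSet_shiftEvent (fun w hw => ?_) hA)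
    (measurableSet_shiftEvent (fun w hw => Finset.mem_map_of_mem _ hw) hB) ?_ _ ?_ ?_
  · rw [Box.mem_sites_shift] at hw
    simpa [sub_eq_add_neg] using hw
  · intro z hz w hw
    obtain ⟨y, hy, rfl⟩ := Finset.mem_map.1 hz
    have := hdist y hy (w + p) (by rw [Box.mem_sites_shift]; simpa using hw)
    rw [← dist_add_right _ w p]
    simpa using this
  · intro w hw
    rw [Box.mem_sites_shift]
    refine hL ?_
    rw [Box.mem_sites_shift]
    simpa using hw
  · intro z hz
    obtain ⟨y, hy, rfl⟩ := Finset.mem_map.1 hz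
    rw [Box.mem_sites_shift]
    simpa using hS hy

lemma DecoupledWith.prod_lintegral_le (h : μ.DecoupledWith g c) {m : ℕ+}
    {ι : Type*} (p : ι → Fin d → ℤ) {L : Box d} (J : Finset ι)
    (hL : ∀ j ∈ J, ((Box.std d m).shift (p j)).sites ⊆ L.sites)
    (hfar : ∀ i ∈ J, ∀ j ∈ J, i ≠ j → ∀ z ∈ ((Box.std d m).shift (p i)).sites,
      ∀ w ∈ ((Box.std d m).shift (p j)).sites, g m < dist z w)
    (f : ι → X → ℝ≥0∞) (hf : ∀ j, Measurable (f j)) :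
    ∏ j ∈ J, (ENNReal.ofReal (Real.exp (-c m)) * ∫⁻ x, f j x ∂(μ.cramer m)) ≤
      ∫⁻ σ, ∏ j ∈ J, f j (mean ((Box.std d m).shift (p j)) σ) ∂(μ.law L) := by
  classical
  induction J using Finset.induction_on with
  | empty => simp [μ.prob]
  | insert i J hi ih =>
    set S : Finset (Fin d → ℤ) := J.biUnion fun j => ((Box.std d m).shift (p j)).sites with hS
    have hLi := hL i (Finset.mem_insert_self _ _)
    have hSL : S ⊆ L.sites :=
      Finset.biUnion_subset.2 fun j hj => hL j (Finset.mem_insert_of_mem hj)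
    have hJ : Measurable[algebra X S]
        (fun σ => ∏ j ∈ J, f j (mean ((Box.std d m).shift (p j)) σ)) :=
      Finset.measurable_fun_prod _ fun j hj => (hf j).comp
        (measurable_mean (Finset.subset_biUnion_of_mem (fun j => ((Box.std d m).shift (p j)).sites)
          hj))
    have step := mul_lintegral_mul_lintegral_le (algebra_mono hLi) (algebra_mono hSL) (μ.law L)
      (ENNReal.ofReal (Real.exp (-c m)))
      (fun A B hA hB => h.shift hA hB (fun z hz w hw => ?_) hLi hSL)
      _ _ ((hf i).comp (measurable_mean subset_rfl)) hJ
    swap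
    · obtain ⟨j, hj, hz⟩ := Finset.mem_biUnion.1 hz
      exact hfar j (Finset.mem_insert_of_mem hj) i (Finset.mem_insert_self _ _)
        (fun e => hi (e ▸ hj)) z hz w hw
    simp only [Function.comp_def] at step
    rw [μ.lintegral_mean_eq hLi (hf i)] at step
    rw [Finset.prod_insert hi]
    simp only [Finset.prod_insert hi]
    refine le_trans ?_ step
    gcongr
    exact ih (fun j hj => hL j (Finset.mem_insert_of_mem hj)) fun i hi j hj =>
      hfar i (Finset.mem_insert_of_mem hi) j (Finset.mem_insert_of_mem hj)

end InvSystem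

end Algebra

/-! ### Tilings of large boxes by distant cells -/

section Tiling

variable {d : ℕ}

/-- The period of the tiling: cells of side `m` are separated by more than `g m`. -/
noncomputable def period (g : ℕ+ → ℝ) (m : ℕ+) : ℕ := m + ⌊g m⌋₊ + 1

lemma le_period (g : ℕ+ → ℝ) (m : ℕ+) : (m : ℕ) ≤ period g m := by
  unfold period
  omega

lemma tendsto_div_period {g : ℕ+ → ℝ} (hg0 : ∀ m, 0 ≤ g m)
    (hg : Tendsto (fun m : ℕ+ => g m / ((m : ℕ) : ℝ)) atTop (𝓝 0)) :
    Tendsto (fun m : ℕ+ => ((m : ℕ) : ℝ) / period g m) atTop (𝓝 1) := by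
  have h1 : Tendsto (fun m : ℕ+ => (1 : ℝ) / ((m : ℕ) : ℝ)) atTop (𝓝 0) :=
    tendsto_one_div_atTop_nhds_zero_nat.comp tendsto_PNat_val_atTop_atTop
  have h2 : Tendsto (fun m : ℕ+ => (1 + g m / ((m : ℕ) : ℝ) + 1 / ((m : ℕ) : ℝ))⁻¹) atTop
      (𝓝 1) := by
    simpa using ((hg.const_add 1).add h1).inv₀ (by norm_num)
  refine tendsto_of_tendsto_of_tendsto_of_le_of_le h2 tendsto_const_nhds (fun m => ?_) fun m => ?_
  · have hm : (0 : ℝ) < ((m : ℕ) : ℝ) := by exact_mod_cast m.pos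
    have hfl : (⌊g m⌋₊ : ℝ) ≤ g m := Nat.floor_le (hg0 m)
    have hp : (period g m : ℝ) = m + ⌊g m⌋₊ + 1 := by simp [period]
    have hg0m := hg0 m
    have : (1 + g m / ((m : ℕ) : ℝ) + 1 / ((m : ℕ) : ℝ))⁻¹ = ((m : ℕ) : ℝ) / (m + g m + 1) := by
      field_simp
    simp only [this, hp]
    gcongr
  · have h := le_period g m
    have : 0 < period g m := m.pos.trans_le h
    exact div_le_one_of_le₀ (Nat.cast_le.2 h) (by positivity)

/-- The corner of the cell of index `j` of the tiling with period `q`. -/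
def cellCorner (q : ℕ) {k : ℕ} (j : Fin d → Fin k) : Fin d → ℤ := fun i => (q : ℤ) * (j i : ℕ)

/-- The cell of side `m` and index `j` of the tiling with period `q`. -/
def cell (m : ℕ+) (q : ℕ) {k : ℕ} (j : Fin d → Fin k) : Box d :=
  (Box.std d m).shift (cellCorner q j)

lemma mem_cell {m : ℕ+} {q k : ℕ} {j : Fin d → Fin k} {z : Fin d → ℤ} :
    z ∈ (cell m q j).sites ↔ ∀ i, (q : ℤ) * (j i : ℕ) ≤ z i ∧ z i < q * (j i : ℕ) + (m : ℕ) := by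
  simp [cell, Box.mem_sites, Box.shift, Box.std, cellCorner]

lemma card_cell (m : ℕ+) (q : ℕ) {k : ℕ} (j : Fin d → Fin k) :
    (cell m q j).sites.card = (m : ℕ) ^ d := Box.card_sites _

lemma cell_subset {m N : ℕ+} {q k : ℕ} (hq : (m : ℕ) ≤ q) (hN : k * q ≤ N) (j : Fin d → Fin k) :
    (cell m q j).sites ⊆ (Box.std d N).sites := by
  intro z hz
  rw [mem_cell] at hz
  simp only [Box.mem_sites, Box.std, Pi.zero_apply]
  intro i
  obtain ⟨h1, h2⟩ := hz i
  have h3 : (q : ℤ) * (j i : ℕ) + q ≤ q * k := by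
    have : (((j i : ℕ) + 1 : ℕ) : ℤ) ≤ k := by exact_mod_cast (j i).isLt
    push_cast at this
    nlinarith
  have h4 : (k : ℤ) * q ≤ (N : ℕ) := by exact_mod_cast hN
  have h5 : (0 : ℤ) ≤ q * (j i : ℕ) := by positivity
  constructor
  · omega
  · nlinarith

lemma cell_far {g : ℕ+ → ℝ} {m : ℕ+} {k : ℕ} {i j : Fin d → Fin k} (hij : i ≠ j)
    {z w : Fin d → ℤ} (hz : z ∈ (cell m (period g m) i).sites)
    (hw : w ∈ (cell m (period g m) j).sites) : g m < dist z w := by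
  rw [mem_cell] at hz hw
  obtain ⟨l, hl⟩ := Function.ne_iff.1 hij
  refine lt_of_lt_of_le ?_ (dist_le_pi_dist z w l)
  obtain ⟨h1, h2⟩ := hz l
  obtain ⟨h3, h4⟩ := hw l
  have hl' : ((i l : ℕ) : ℤ) ≠ (j l : ℕ) := by
    exact_mod_cast fun e => hl (Fin.ext e)
  have hfl : g m < (⌊g m⌋₊ : ℝ) + 1 := Nat.lt_floor_add_one _
  have key : (⌊g m⌋₊ : ℤ) + 1 ≤ |z l - w l| := by
    have hp : (period g m : ℤ) = (m : ℕ) + ⌊g m⌋₊ + 1 := by simp [period]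
    have hp0 : (0 : ℤ) ≤ period g m := by positivity
    rcases lt_or_gt_of_ne hl' with h | h
    · have : (period g m : ℤ) * (i l : ℕ) + period g m ≤ period g m * (j l : ℕ) := by nlinarith
      rw [le_abs]
      right
      omega
    · have : (period g m : ℤ) * (j l : ℕ) + period g m ≤ period g m * (i l : ℕ) := by nlinarith
      rw [le_abs]
      left
      omega
  rw [Int.dist_eq]
  refine hfl.trans_le ?_
  exact_mod_cast key

lemma cell_disjoint {g : ℕ+ → ℝ} (hg0 : ∀ m, 0 ≤ g m) {m : ℕ+} {k : ℕ} {i j : Fin d → Fin k}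
    (hij : i ≠ j) :
    Disjoint (cell m (period g m) i).sites (cell m (period g m) j).sites :=
  Finset.disjoint_left.2 fun z hz hw => by
    have := cell_far hij hz hw
    rw [dist_self] at this
    exact (hg0 m).not_gt this

/-- The union of the cells. -/
noncomputable def cells (d : ℕ) (m : ℕ+) (q k : ℕ) : Finset (Fin d → ℤ) :=
  Finset.univ.biUnion fun j : Fin d → Fin k => (cell m q j).sites

/-- The sites of the box of side `N` that belong to no cell. -/
noncomputable def gap (d : ℕ) (m N : ℕ+) (q k : ℕ) : Finset (Fin d → ℤ) :=
  (Box.std d N).sites \ cells d m q k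

lemma cells_subset {m N : ℕ+} {q k : ℕ} (hq : (m : ℕ) ≤ q) (hN : k * q ≤ N) :
    cells d m q k ⊆ (Box.std d N).sites :=
  Finset.biUnion_subset.2 fun j _ => cell_subset hq hN j

lemma card_gap {g : ℕ+ → ℝ} (hg0 : ∀ m, 0 ≤ g m) {m N : ℕ+} {k : ℕ} (hN : k * period g m ≤ N) :
    (gap d m N (period g m) k).card = (N : ℕ) ^ d - (k * m) ^ d := by
  rw [gap, Finset.card_sdiff_of_subset (cells_subset (le_period g m) hN), Box.card_std, cells,
    Finset.card_biUnion fun i _ j _ hij => cell_disjoint hg0 hij]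
  simp [card_cell, mul_pow]

lemma sum_box_eq {X : Type*} [AddCommGroup X] [Module ℝ X] {g : ℕ+ → ℝ} (hg0 : ∀ m, 0 ≤ g m)
    {m N : ℕ+} {k : ℕ} (hN : k * period g m ≤ N) (σ : Config d X) :
    (((N : ℕ) : ℝ) ^ d) • mean (Box.std d N) σ =
      ∑ j : Fin d → Fin k, (((m : ℕ) : ℝ) ^ d) • mean (cell m (period g m) j) σ +
        ∑ z ∈ gap d m N (period g m) k, σ z := by
  have h1 := card_smul_mean (Box.std d N) σ
  rw [Box.card_std] at h1
  push_cast at h1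
  rw [h1, gap, ← Finset.sum_sdiff (cells_subset (le_period g m) hN), add_comm, cells,
    Finset.sum_biUnion fun i _ j _ hij => cell_disjoint hg0 hij]
  congr 1
  refine Finset.sum_congr rfl fun j _ => ?_
  rw [← card_smul_mean, card_cell]
  push_cast
  rfl

variable {X : Type*} [AddCommGroup X] [Module ℝ X] [MeasurableSpace X]

/-- Decoupling of the cells of a tiling and control of the remaining sites. -/
lemma InvSystem.DecoupledWith.tiling_lintegral_le {μ : InvSystem d X} {g c : ℕ+ → ℝ}
    (h : μ.DecoupledWith g c) (hg0 : ∀ m, 0 ≤ g m) {α : ℝ} {A : Set X} (hA : MeasurableSet A)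
    (hα : μ.SiteBound α A) {m N : ℕ+} {k : ℕ} (hN : k * period g m ≤ N)
    (f : (Fin d → Fin k) → X → ℝ≥0∞) (hf : ∀ j, Measurable (f j)) :
    (∏ j, (ENNReal.ofReal (Real.exp (-c m)) * ∫⁻ x, f j x ∂(μ.cramer m))) *
        ENNReal.ofReal α ^ ((N : ℕ) ^ d - (k * m) ^ d) ≤
      ∫⁻ σ, (∏ j, f j (mean (cell m (period g m) j) σ)) *
        ∏ z ∈ gap d m N (period g m) k, A.indicator 1 (σ z) ∂(μ.law (Box.std d N)) := by
  have hq := le_period g m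
  have h1 := h.prod_lintegral_le (m := m) (L := Box.std d N) (cellCorner (period g m))
    (Finset.univ : Finset (Fin d → Fin k)) (fun j _ => cell_subset hq hN j)
    (fun i _ j _ hij z hz w hw => cell_far hij hz hw) f hf
  have h2 := hα.lintegral_le hA (cells_subset (d := d) hq hN)
    (G := gap d m N (period g m) k) Finset.sdiff_subset Finset.disjoint_sdiff
    (f := fun σ => ∏ j, f j (mean (cell m (period g m) j) σ))
    (Finset.measurable_fun_prod _ fun j hj => (hf j).comp (measurable_mean
      (Finset.subset_biUnion_of_mem (fun j : Fin d → Fin k => (cell m (period g m) j).sites) hj)))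
  rw [card_gap hg0 hN] at h2
  refine le_trans ?_ h2
  rw [mul_comm]
  gcongr
  exact h1

end Tiling

/-! ### Internal convex sets -/

section Internal

variable {X : Type*} [AddCommGroup X] [Module ℝ X] {C : Set X}

lemma minkowski_le {t : ℝ≥0} {x : X} (h : x ∈ (t : ℝ) • C) : minkowski C x ≤ t :=
  iInf₂_le t h

lemma exists_of_minkowski_lt {x : X} {a : ℝ≥0∞} (h : minkowski C x < a) :
    ∃ t : ℝ≥0, x ∈ (t : ℝ) • C ∧ (t : ℝ≥0∞) < a := by
  obtain ⟨t, ht⟩ := iInf_lt_iff.1 h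
  obtain ⟨hx, ht⟩ := iInf_lt_iff.1 ht
  exact ⟨t, hx, ht⟩

lemma IsInternal.zero_mem (h : IsInternal C) : (0 : X) ∈ C := by
  obtain ⟨t, ⟨y, hy, -⟩, -⟩ := exists_of_minkowski_lt (h.finite 0)
  rw [h.eq_ball]
  refine (minkowski_le (t := 0) (C := C) ⟨y, hy, by simp⟩).trans_lt (by simp)

lemma IsInternal.exists_pos_mem_smul (h : IsInternal C) (x : X) : ∃ r : ℝ, 0 < r ∧ x ∈ r • C := by
  obtain ⟨t, ⟨y, hy, rfl⟩, -⟩ := exists_of_minkowski_lt (h.finite x)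
  have ht : (0 : ℝ) < t + 1 := by positivity
  refine ⟨t + 1, ht, ⟨((t : ℝ) / (t + 1)) • y, ?_, ?_⟩⟩
  · exact h.convex.smul_mem_of_zero_mem h.zero_mem hy
      ⟨by positivity, div_le_one_of_le₀ (by linarith) ht.le⟩
  · simp only [smul_smul]
    congr 1
    field_simp

lemma IsInternal.absorbent (h : IsInternal C) : Absorbent ℝ C := by
  rw [absorbent_iff_eventually_nhdsNE_zero]
  intro x
  obtain ⟨r, hr, y, hy, hyx⟩ := h.exists_pos_mem_smul x
  obtain ⟨r', hr', y', hy', hyx'⟩ := h.exists_pos_mem_smul (-x)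
  have h1 : ∀ᶠ c : ℝ in 𝓝 0, c * r < 1 :=
    ((continuous_id.mul continuous_const).tendsto' (0 : ℝ) 0 (by simp)).eventually
      (gt_mem_nhds one_pos)
  have h2 : ∀ᶠ c : ℝ in 𝓝 0, -c * r' < 1 :=
    ((continuous_id.neg.mul continuous_const).tendsto' (0 : ℝ) 0 (by simp)).eventually
      (gt_mem_nhds one_pos)
  refine mem_nhdsWithin_of_mem_nhds ?_
  filter_upwards [h1, h2] with c hc1 hc2
  rcases le_total 0 c with hc | hc
  · have : c • x = (c * r) • y := by rw [mul_smul]; exact congrArg _ hyx.symm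
    change c • x ∈ C
    rw [this]
    exact h.convex.smul_mem_of_zero_mem h.zero_mem hy ⟨by positivity, hc1.le⟩
  · have : c • x = (-c * r') • y' := by
      rw [mul_smul, show r' • y' = -x from hyx', neg_smul, smul_neg, neg_neg]
    change c • x ∈ C
    rw [this]
    exact h.convex.smul_mem_of_zero_mem h.zero_mem hy'
      ⟨mul_nonneg (by linarith) hr'.le, hc2.le⟩

lemma isInternal_abs_lt_one {l : X → ℝ} (hl : IsLinearMap ℝ l) :
    IsInternal {x | |l x| < 1} := by
  have hmem : ∀ (x : X) (t : ℝ≥0), |l x| < t → x ∈ (t : ℝ) • {x | |l x| < 1} := fun x t ht => by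
    have ht0 : (0 : ℝ) < t := (abs_nonneg _).trans_lt ht
    refine (mem_smul_set_iff_inv_smul_mem₀ ht0.ne' _ _).2 ?_
    simp only [mem_ofPred_eq, hl.map_smul, smul_eq_mul, abs_mul, abs_inv, abs_of_pos ht0]
    rwa [inv_mul_lt_one₀ ht0]
  refine ⟨?_, fun x => ?_, ?_⟩
  · have : {x | |l x| < 1} = (hl.mk' l) ⁻¹' Metric.ball 0 1 := by
      ext x
      simp
    rw [this]
    exact (convex_ball _ _).linear_preimage _
  · exact (minkowski_le (hmem x (Real.nnabs (l x) + 1) (by simp))).trans_lt ENNReal.coe_lt_top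
  · ext x
    constructor
    · intro hx
      obtain ⟨t, h1, h2⟩ := exists_between (show |l x| < 1 from hx)
      lift t to ℝ≥0 using (abs_nonneg _).trans h1.le
      exact (minkowski_le (hmem x t h1)).trans_lt (by exact_mod_cast h2)
    · intro hx
      obtain ⟨t, ⟨y, hy, rfl⟩, ht⟩ := exists_of_minkowski_lt (show minkowski _ x < 1 from hx)
      have ht1 : (t : ℝ) < 1 := by exact_mod_cast ht
      simp only [mem_ofPred_eq, hl.map_smul, smul_eq_mul, abs_mul, NNReal.abs_eq] at hy ⊢
      nlinarith [abs_nonneg (l y), t.coe_nonneg]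

/-- A mean of many points close to their targets and of few controlled points. -/
lemma mem_vadd_of_sum_eq (hC : IsInternal C) {ι κ : Type*} (I : Finset ι) (G : Finset κ) {V N t : ℝ}
    (hV : 0 < V) (hN : 0 < N) (hcount : V * I.card + G.card = N) (ht : 0 ≤ t) {w M : X}
    {a e : ι → X} {b : κ → X} (he : V • ∑ i ∈ I, e i = (V * I.card) • w)
    (hsum : N • M = ∑ i ∈ I, V • a i + ∑ z ∈ G, b z) (ha : ∀ i ∈ I, a i ∈ e i +ᵥ (2⁻¹ : ℝ) • C)
    (hb : ∀ z ∈ G, b z ∈ t • C) (hG : G.card * (t + gauge C (-w)) ≤ 4⁻¹ * N) :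
    M ∈ w +ᵥ C := by
  have habs := hC.absorbent
  have hconv := hC.convex
  rw [mem_vadd_set_iff_neg_vadd_mem, vadd_eq_add]
  have key : -w + M = N⁻¹ • (∑ i ∈ I, V • (a i - e i) + ∑ z ∈ G, (b z + -w)) := by
    rw [eq_inv_smul_iff₀ hN.ne', smul_add, hsum]
    simp only [smul_sub, Finset.sum_sub_distrib, ← Finset.smul_sum, Finset.sum_add_distrib,
      Finset.sum_const]
    rw [he, ← hcount, smul_neg, add_smul, Nat.cast_smul_eq_nsmul, smul_neg]
    abel
  refine setOfPred_gauge_lt_one_subset_self hconv hC.zero_mem habs ?_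
  have e1 : gauge C (∑ i ∈ I, V • (a i - e i)) ≤ V * I.card * 2⁻¹ := by
    refine (gauge_sum_le hconv habs I _).trans ?_
    refine (Finset.sum_le_card_nsmul I _ (V * 2⁻¹) fun i hi => ?_).trans_eq ?_
    · rw [gauge_smul_of_nonneg hV.le, smul_eq_mul]
      have : a i - e i ∈ (2⁻¹ : ℝ) • C := by
        have := ha i hi
        rw [mem_vadd_set_iff_neg_vadd_mem, vadd_eq_add] at this
        rwa [sub_eq_neg_add]
      gcongr
      exact gauge_le_of_mem (by norm_num) this
    · rw [nsmul_eq_mul]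
      ring
  have e2 : gauge C (∑ z ∈ G, (b z + -w)) ≤ G.card * (t + gauge C (-w)) := by
    refine (gauge_sum_le hconv habs G _).trans ?_
    refine (Finset.sum_le_card_nsmul G _ (t + gauge C (-w)) fun z hz => ?_).trans_eq
      (nsmul_eq_mul _ _)
    refine (gauge_add_le hconv habs _ _).trans ?_
    gcongr
    exact gauge_le_of_mem ht (hb z hz)
  have e3 : gauge C (-w + M) ≤ N⁻¹ * (V * I.card * 2⁻¹ + G.card * (t + gauge C (-w))) := by
    rw [key, gauge_smul_of_nonneg (inv_nonneg.2 hN.le), smul_eq_mul]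
    gcongr
    exact (gauge_add_le hconv habs _ _).trans (add_le_add e1 e2)
  refine lt_of_le_of_lt e3 ?_
  rw [inv_mul_lt_one₀ hN]
  have : (0 : ℝ) ≤ G.card := by positivity
  linarith

end Internal

/-! ### Rates of neighbourhoods and of exponential moments -/

section Rates

variable {X : Type*} [AddCommGroup X] [Module ℝ X] [MeasurableSpace X] {d : ℕ}

lemma logRate_eq {E : Type*} [MeasurableSpace E] (ν : ℕ+ → Measure E) (A : Set E) :
    logRate d ν A = fun n : ℕ+ => ENNReal.log (ν n A) / (((n : ℕ) ^ d : ℕ) : EReal) := by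
  funext n
  rw [logRate, Box.card_std]

@[to_additive]
lemma prod_ite_mem_const {ι M : Type*} [Fintype ι] [DecidableEq ι] [CommMonoid M] (J : Finset ι)
    (a b : M) : ∏ j, (if j ∈ J then a else b) = a ^ J.card * b ^ Jᶜ.card := by
  rw [Finset.prod_ite, Finset.prod_const, Finset.prod_const, Finset.filter_mem_eq_inter,
    Finset.univ_inter]
  congr 3
  ext j
  simp

lemma measurableSet_vadd (hX : IsStableAlgebra X) {C : Set X} (hC : MeasurableSet C) (x : X) :
    MeasurableSet (x +ᵥ C) := hX.translation x C hC

/-- The standing assumptions on the system, with explicit decoupling constants. -/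
structure Decoupling (μ : InvSystem d X) (g c : ℕ+ → ℝ) : Prop where
  nonneg : ∀ m, 0 ≤ g m
  tendsto_gap : Tendsto (fun m : ℕ+ => g m / ((m : ℕ) : ℝ)) atTop (𝓝 0)
  tendsto_cost : Tendsto (fun m : ℕ+ => c m / (((m : ℕ) ^ d : ℕ) : ℝ)) atTop (𝓝 0)
  le : μ.DecoupledWith g c

lemma exists_decoupling {μ : InvSystem d X} (h : μ.LowerDecoupled) :
    ∃ g c, Decoupling μ g c := by
  obtain ⟨g, c, h1, -, h3, h4, h5⟩ := h
  exact ⟨g, c, h1, h3, by simpa only [Box.card_std] using h4, h5⟩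

lemma exists_siteBound {μ : InvSystem d X} (h : μ.LocallyControlled) {C : Set X}
    (hC : C ∈ internalSets X) : ∃ t α : ℝ, 0 < t ∧ 0 < α ∧ μ.SiteBound α (t • C) := by
  obtain ⟨t, α, h⟩ := h
  exact ⟨t C, α C, (h C hC).1, (h C hC).2.1, (h C hC).2.2⟩

variable {μ : InvSystem d X} {g c : ℕ+ → ℝ}

/-- Midpoint concavity of the rates of neighbourhoods. -/
lemma Decoupling.limsup_rate_le (hd : 0 < d) (h : Decoupling μ g c) (hX : IsStableAlgebra X)
    (hctl : μ.LocallyControlled) {C : Set X} (hC : C ∈ internalSets X) (x y : X) :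
    limsup (fun n : ℕ+ => ENNReal.log ((μ.cramer n (x +ᵥ (2⁻¹ : ℝ) • C) *
        μ.cramer n (y +ᵥ (2⁻¹ : ℝ) • C)) ^ (2⁻¹ : ℝ)) / (((n : ℕ) ^ d : ℕ) : EReal)) atTop ≤
      liminf (logRate d μ.cramer ((2⁻¹ : ℝ) • (x + y) +ᵥ C)) atTop := by
  classical
  obtain ⟨t, α, ht, hα, hsite⟩ := exists_siteBound hctl hC
  have hC' : MeasurableSet ((2⁻¹ : ℝ) • C) := hX.dilation _ _ (by norm_num) hC.2
  have hx := measurableSet_vadd hX hC' x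
  have hy := measurableSet_vadd hX hC' y
  have htC : MeasurableSet (t • C) := hX.dilation _ _ ht.ne' hC.2
  set w : X := (2⁻¹ : ℝ) • (x + y) with hw
  have hwC := measurableSet_vadd hX hC.2 w
  set r := t + gauge C (-w) with hr
  have hr0 : 0 < r := add_pos_of_pos_of_nonneg ht (gauge_nonneg _)
  rw [logRate_eq]
  refine limsup_rate_le_liminf_rate h.tendsto_cost (le_period g)
    (tendsto_div_period h.nonneg h.tendsto_gap) _ _ hα (δ := (4 * r)⁻¹) (by positivity)
    fun m => Eventually.of_forall fun N k hk hk2 hkN hδ => ?_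
  set K := k ^ d with hK
  have hK2 : Even K := hk2.pow_of_ne_zero hd.ne'
  obtain ⟨H, hH⟩ := hK2
  have hcardJ : Fintype.card (Fin d → Fin k) = K := by simp [hK]
  obtain ⟨J, -, hJ⟩ := Finset.exists_subset_card_eq
    (show H ≤ (Finset.univ : Finset (Fin d → Fin k)).card by
      rw [Finset.card_univ, hcardJ]; omega)
  have hJc : Jᶜ.card = H := by rw [Finset.card_compl, hcardJ, hJ]; omega
  let f : (Fin d → Fin k) → X → ℝ≥0∞ := fun j => if j ∈ J then
    (x +ᵥ (2⁻¹ : ℝ) • C).indicator 1 else (y +ᵥ (2⁻¹ : ℝ) • C).indicator 1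
  have hf : ∀ j, Measurable (f j) := fun j => by
    dsimp only [f]
    split_ifs
    exacts [measurable_one.indicator hx, measurable_one.indicator hy]
  have key := h.le.tiling_lintegral_le h.nonneg htC hsite hkN f hf
  refine le_trans (le_of_eq ?_) (key.trans ?_)
  · congr 1
    have : ∀ j, ∫⁻ z, f j z ∂(μ.cramer m) = if j ∈ J then μ.cramer m (x +ᵥ (2⁻¹ : ℝ) • C) else
        μ.cramer m (y +ᵥ (2⁻¹ : ℝ) • C) := fun j => by
      dsimp only [f]
      split_ifs
      · exact lintegral_indicator_one hx
      · exact lintegral_indicator_one hy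
    rw [Finset.prod_mul_distrib, Finset.prod_congr rfl fun j _ => this j,
      prod_ite_mem_const, hJ, hJc, mul_pow]
    congr 1
    · simp [hK]
    · rw [← mul_pow, ← ENNReal.rpow_natCast, ← ENNReal.rpow_mul, ← ENNReal.rpow_natCast, hH]
      congr 1
      push_cast
      ring
  · rw [μ.cramer_apply hwC, ← lintegral_indicator_one
      (measurable_mean subset_rfl hwC)]
    refine lintegral_mono fun σ => ?_
    by_cases hmem : mean (Box.std d N) σ ∈ w +ᵥ C
    · rw [indicator_of_mem (show σ ∈ mean (Box.std d N) ⁻¹' (w +ᵥ C) from hmem)]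
      refine mul_le_one' (Finset.prod_le_one' fun j _ => ?_) (Finset.prod_le_one' fun z _ => ?_)
      · dsimp only [f]
        split_ifs <;> exact indicator_le_self' (by simp) _
      · exact indicator_le_self' (by simp) _
    · refine le_of_eq_of_le (by_contra fun hne => hmem ?_) zero_le
      rw [mul_eq_zero, not_or, ← ne_eq, ← ne_eq, Finset.prod_ne_zero_iff,
        Finset.prod_ne_zero_iff] at hne
      obtain ⟨h1, h2⟩ := hne
      have hmpos : (0 : ℝ) < ((m : ℕ) : ℝ) ^ d := by have := m.pos; positivity
      have hNpos : (0 : ℝ) < ((N : ℕ) : ℝ) ^ d := by have := N.pos; positivity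
      have hle : (k * m) ^ d ≤ (N : ℕ) ^ d :=
        Nat.pow_le_pow_left ((Nat.mul_le_mul_left k (le_period g m)).trans hkN) d
      have hgap : ((gap d m N (period g m) k).card : ℝ) =
          ((N : ℕ) : ℝ) ^ d - ((k : ℝ) * ((m : ℕ) : ℝ)) ^ d := by
        rw [card_gap h.nonneg hkN, Nat.cast_sub hle]
        push_cast
        rfl
      refine mem_vadd_of_sum_eq hC.1 Finset.univ (gap d m N (period g m) k) hmpos hNpos ?_ ht.le
        (e := fun j => if j ∈ J then x else y) ?_ (sum_box_eq h.nonneg hkN σ) (fun j _ => ?_)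
        (fun z hz => ?_) ?_
      · rw [hgap, Finset.card_univ, hcardJ, hK, mul_pow]
        push_cast
        ring
      · rw [sum_ite_mem_const, hJ, hJc, Finset.card_univ, hcardJ, mul_smul, hw, hH, ← smul_add,
          ← Nat.cast_smul_eq_nsmul ℝ, smul_smul ((H + H : ℕ) : ℝ)]
        congr 2
        push_cast
        ring
      · have := h1 j (Finset.mem_univ _)
        dsimp only [f] at this
        split_ifs at this ⊢
        · exact mem_of_indicator_ne_zero this
        · exact mem_of_indicator_ne_zero this
      · exact mem_of_indicator_ne_zero (h2 z hz)
      · rw [hgap]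
        have : ((N : ℕ) : ℝ) ^ d - ((k : ℝ) * ((m : ℕ) : ℝ)) ^ d ≤ (4 * r)⁻¹ * ((N : ℕ) : ℝ) ^ d := by
          linarith
        calc _ ≤ (4 * r)⁻¹ * ((N : ℕ) : ℝ) ^ d * r := by gcongr
          _ = _ := by field_simp

/-- The upper rate of a small neighbourhood is at most the lower rate of a larger one. -/
lemma Decoupling.limsup_logRate_le (hd : 0 < d) (h : Decoupling μ g c) (hX : IsStableAlgebra X)
    (hctl : μ.LocallyControlled) {C : Set X} (hC : C ∈ internalSets X) (x : X) :
    limsup (logRate d μ.cramer (x +ᵥ (2⁻¹ : ℝ) • C)) atTop ≤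
      liminf (logRate d μ.cramer (x +ᵥ C)) atTop := by
  have := h.limsup_rate_le hd hX hctl hC x x
  have h2 : (2⁻¹ : ℝ) • (x + x) = x := by
    rw [← two_smul ℝ, smul_smul]
    norm_num
  rw [h2] at this
  refine le_trans (le_of_eq ?_) this
  rw [logRate_eq]
  congr 1
  funext n
  rw [← sq, ← ENNReal.rpow_natCast, ← ENNReal.rpow_mul]
  norm_num

/-- Midpoint concavity for real minorants. -/
lemma Decoupling.le_liminf_midpoint (hd : 0 < d) (h : Decoupling μ g c) (hX : IsStableAlgebra X)
    (hctl : μ.LocallyControlled) {C : Set X} (hC : C ∈ internalSets X) {x y : X} {a b : ℝ}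
    (ha : (a : EReal) < liminf (logRate d μ.cramer (x +ᵥ (2⁻¹ : ℝ) • C)) atTop)
    (hb : (b : EReal) < liminf (logRate d μ.cramer (y +ᵥ (2⁻¹ : ℝ) • C)) atTop) :
    (((a + b) / 2 : ℝ) : EReal) ≤ liminf (logRate d μ.cramer ((2⁻¹ : ℝ) • (x + y) +ᵥ C)) atTop := by
  refine le_trans ?_ (h.limsup_rate_le hd hX hctl hC x y)
  refine le_limsup_of_frequently_le (Eventually.frequently ?_) (by isBoundedDefault)
  filter_upwards [eventually_lt_of_lt_liminf ha (by isBoundedDefault),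
    eventually_lt_of_lt_liminf hb (by isBoundedDefault)] with n hna hnb
  have hn : 0 < (n : ℕ) ^ d := by have := n.pos; positivity
  rw [logRate_eq] at hna hnb
  have h1 := (coe_le_log_div_iff hn _ _).1 hna.le
  have h2 := (coe_le_log_div_iff hn _ _).1 hnb.le
  rw [coe_le_log_div_iff hn]
  refine le_trans ?_ (ENNReal.rpow_le_rpow (mul_le_mul' h1 h2) (by norm_num))
  rw [← ENNReal.ofReal_mul (by positivity), ENNReal.ofReal_rpow_of_nonneg (by positivity)
    (by norm_num), ← Real.exp_add, ← Real.exp_mul]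
  apply le_of_eq
  congr 2
  ring

end Rates

/-! ### Pressure -/

section Pressure

lemma entropy_le_liminf {X : Type*} [AddCommGroup X] [MeasurableSpace X] {d : ℕ}
    {C₀ : Set (Set X)} (ν : ℕ+ → Measure X) {C : Set X} (hC : C ∈ C₀) (x : X) :
    entropy d (nbhds C₀) ν x ≤ liminf (logRate d ν (x +ᵥ C)) atTop :=
  iInf₂_le (x +ᵥ C) ⟨C, hC, rfl⟩

variable {X : Type*} [AddCommGroup X] [Module ℝ X] {d : ℕ}

/-- The exponential weight of the cells is controlled by that of the box, if the remaining sites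
are bounded below. -/
lemma prod_exp_mul_le (l : X →ₗ[ℝ] ℝ) {g : ℕ+ → ℝ} (hg0 : ∀ m, 0 ≤ g m) {m N : ℕ+} {k : ℕ}
    (hN : k * period g m ≤ N) {b : ℝ} {σ : Config d X}
    (hb : ∀ z ∈ gap d m N (period g m) k, -b ≤ l (σ z)) :
    (∏ j : Fin d → Fin k, ENNReal.ofReal (Real.exp (((m : ℕ) : ℝ) ^ d *
        l (mean (cell m (period g m) j) σ)))) *
        ENNReal.ofReal (Real.exp (-b)) ^ ((N : ℕ) ^ d - (k * m) ^ d) ≤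
      ENNReal.ofReal (Real.exp (((N : ℕ) : ℝ) ^ d * l (mean (Box.std d N) σ))) := by
  have h1 := congrArg l (sum_box_eq hg0 hN σ)
  simp only [map_smul, map_add, map_sum, smul_eq_mul] at h1
  rw [h1, ← ENNReal.ofReal_prod_of_nonneg fun _ _ => (Real.exp_pos _).le,
    ← ENNReal.ofReal_pow (Real.exp_pos _).le,
    ← ENNReal.ofReal_mul (Finset.prod_nonneg fun _ _ => (Real.exp_pos _).le), ← Real.exp_sum,
    ← Real.exp_nat_mul, ← Real.exp_add]
  refine ENNReal.ofReal_le_ofReal (Real.exp_le_exp.2 (add_le_add le_rfl ?_))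
  rw [← card_gap hg0 hN, ← nsmul_eq_mul]
  exact Finset.card_nsmul_le_sum _ _ _ hb

lemma neg_le_of_mem_smul_slab [TopologicalSpace X] {l : X →L[ℝ] ℝ} {t : ℝ} (ht : 0 < t) {x : X}
    (hx : x ∈ t • {x | |l x| < 1}) : -t ≤ l x := by
  obtain ⟨y, hy, rfl⟩ := hx
  simp only [mem_ofPred_eq, abs_lt] at hy
  simp only [map_smul, smul_eq_mul]
  nlinarith [hy.1]

variable [MeasurableSpace X]

lemma logRate_nonpos (μ : InvSystem d X) (A : Set X) (n : ℕ+) : logRate d μ.cramer A n ≤ 0 := by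
  have := μ.isProbabilityMeasure_cramer n
  have h := (log_div_le_coe_iff (v := (n : ℕ) ^ d) (by have := n.pos; positivity) 0
    (μ.cramer n A)).2 (by simpa using prob_le_one)
  rw [logRate_eq]
  exact_mod_cast h

variable [TopologicalSpace X]

/-- The exponential moment `∫ exp (n ^ d ⟨l|x⟩) dν_n(x)`. -/
noncomputable def laplace (d : ℕ) (ν : ℕ+ → Measure X) (l : X →L[ℝ] ℝ) (n : ℕ+) : ℝ≥0∞ :=
  ∫⁻ x, ENNReal.ofReal (Real.exp (((n : ℕ) : ℝ) ^ d * l x)) ∂(ν n)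

lemma logLaplace_eq (ν : ℕ+ → Measure X) (l : X →L[ℝ] ℝ) :
    logLaplace d ν l = fun n : ℕ+ =>
      ENNReal.log (laplace d ν l n) / (((n : ℕ) ^ d : ℕ) : EReal) := by
  funext n
  simp only [logLaplace, laplace, Box.card_std]
  push_cast
  rfl

lemma measurable_exp_mul {l : X →L[ℝ] ℝ} (hl : Measurable l) (a : ℝ) :
    Measurable fun x => ENNReal.ofReal (Real.exp (a * l x)) :=
  (Real.measurable_exp.comp (hl.const_mul a)).ennreal_ofReal

lemma slab_mem_internalSets {l : X →L[ℝ] ℝ} (hl : Measurable l) :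
    {x | |l x| < 1} ∈ internalSets X :=
  ⟨isInternal_abs_lt_one l.toLinearMap.isLinear,
    measurableSet_lt (continuous_abs.measurable.comp hl) measurable_const⟩

variable {μ : InvSystem d X} {g c : ℕ+ → ℝ}

lemma Decoupling.tendsto_logLaplace (h : Decoupling μ g c) (hX : IsStableAlgebra X)
    (hctl : μ.LocallyControlled) {l : X →L[ℝ] ℝ} (hl : Measurable l) :
    Tendsto (logLaplace d μ.cramer l) atTop (𝓝 (pressure d μ.cramer l)) := by
  have hC := slab_mem_internalSets hl
  obtain ⟨t, α, ht, hα, hsite⟩ := exists_siteBound hctl hC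
  have htC := hX.dilation _ _ ht.ne' hC.2
  have key : limsup (logLaplace d μ.cramer l) atTop ≤ liminf (logLaplace d μ.cramer l) atTop := by
    rw [logLaplace_eq]
    refine limsup_rate_le_liminf_rate h.tendsto_cost (le_period g)
      (tendsto_div_period h.nonneg h.tendsto_gap) _ _ (κ := α * Real.exp (-t)) (by positivity)
      one_pos fun m => Eventually.of_forall fun N k hk hk2 hkN hδ => ?_
    have h1 := h.le.tiling_lintegral_le h.nonneg htC hsite hkN
      (fun _ x => ENNReal.ofReal (Real.exp (((m : ℕ) : ℝ) ^ d * l x)))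
      (fun _ => measurable_exp_mul hl _)
    rw [Finset.prod_const, Finset.card_univ, Fintype.card_fun, Fintype.card_fin,
      Fintype.card_fin] at h1
    rw [ENNReal.ofReal_mul hα.le, mul_pow (ENNReal.ofReal α), ← mul_assoc]
    refine (mul_le_mul_left h1 _).trans ?_
    rw [← lintegral_mul_const' _ _ (by finiteness), laplace,
      ← μ.lintegral_mean_std (measurable_exp_mul hl _)]
    refine lintegral_mono fun σ => ?_
    by_cases hσ : ∀ z ∈ gap d m N (period g m) k, σ z ∈ t • {x | |l x| < 1}
    · refine le_trans ?_ (prod_exp_mul_le l.toLinearMap h.nonneg hkN (b := t)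
        fun z hz => neg_le_of_mem_smul_slab ht (hσ z hz))
      rw [Finset.prod_congr rfl fun z hz => indicator_of_mem (hσ z hz) _]
      simp
    · push Not at hσ
      obtain ⟨z, hz, hzσ⟩ := hσ
      rw [Finset.prod_eq_zero hz (indicator_of_notMem hzσ _)]
      simp
  exact tendsto_of_le_liminf_of_limsup_le key le_rfl

lemma bot_lt_pressure (hX : IsStableAlgebra X) (hctl : μ.LocallyControlled) {l : X →L[ℝ] ℝ}
    (hl : Measurable l) : ⊥ < pressure d μ.cramer l := by
  have hC := slab_mem_internalSets hl
  obtain ⟨t, α, ht, hα, hsite⟩ := exists_siteBound hctl hC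
  have htC := hX.dilation _ _ ht.ne' hC.2
  refine (EReal.bot_lt_coe (Real.log α - t)).trans_le ?_
  refine le_limsup_of_frequently_le (Eventually.frequently (Eventually.of_forall fun n => ?_))
    (by isBoundedDefault)
  rw [logLaplace_eq, coe_le_log_div_iff (by have := n.pos; positivity)]
  have h1 := hsite.lintegral_le htC (L := Box.std d n) (S := ∅) (G := (Box.std d n).sites)
    (Finset.empty_subset _) subset_rfl (Finset.disjoint_empty_left _) (f := fun _ => 1)
    measurable_const
  rw [lintegral_const, μ.prob, Box.card_std, mul_one, mul_one] at h1
  have h2 : ENNReal.ofReal (Real.exp ((Real.log α - t) * ((n : ℕ) ^ d : ℕ))) =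
      ENNReal.ofReal α ^ (n : ℕ) ^ d * ENNReal.ofReal (Real.exp (-t)) ^ (n : ℕ) ^ d := by
    rw [← mul_pow, ← ENNReal.ofReal_mul hα.le, ← ENNReal.ofReal_pow (by positivity)]
    nth_rw 2 [← Real.exp_log hα]
    rw [← Real.exp_add, ← Real.exp_nat_mul]
    congr 2
    ring
  rw [h2]
  refine (mul_le_mul_left h1 _).trans ?_
  rw [← lintegral_mul_const' _ _ (by finiteness), laplace,
    ← μ.lintegral_mean_std (measurable_exp_mul hl _)]
  refine lintegral_mono fun σ => ?_
  by_cases hσ : ∀ z ∈ (Box.std d n).sites, σ z ∈ t • {x | |l x| < 1}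
  · rw [Finset.prod_congr rfl fun z hz => indicator_of_mem (hσ z hz) _]
    have h3 := congrArg l (card_smul_mean (Box.std d n) σ)
    rw [Box.card_std, map_smul, map_sum, smul_eq_mul] at h3
    push_cast at h3
    rw [h3, ← ENNReal.ofReal_pow (Real.exp_pos _).le, ← Real.exp_nat_mul]
    simp only [Pi.one_apply, Finset.prod_const_one, one_mul]
    refine ENNReal.ofReal_le_ofReal (Real.exp_le_exp.2 ?_)
    rw [← Box.card_std, ← nsmul_eq_mul]
    exact Finset.card_nsmul_le_sum _ _ _ fun z hz => neg_le_of_mem_smul_slab ht (hσ z hz)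
  · push Not at hσ
    obtain ⟨z, hz, hzσ⟩ := hσ
    rw [Finset.prod_eq_zero hz (indicator_of_notMem hzσ _)]
    simp

variable {C₀ : Set (Set X)}

lemma exists_mem_subset_of_mem_nhds (hX : IsMeasurableLCS C₀) {U : Set X} (hU : U ∈ 𝓝 (0 : X)) :
    ∃ C ∈ C₀, C ⊆ U := hX.basis.mem_iff.1 hU

lemma exists_mem_abs_lt (hX : IsMeasurableLCS C₀) (l : X →L[ℝ] ℝ) {ε : ℝ} (hε : 0 < ε) :
    ∃ C ∈ C₀, ∀ x ∈ C, |l x| < ε := by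
  refine exists_mem_subset_of_mem_nhds hX (U := {x | |l x| < ε}) ?_
  exact (l.continuous.abs.tendsto' 0 0 (by simp)).eventually (gt_mem_nhds hε)

lemma entropy_nonpos (hX : IsMeasurableLCS C₀) (μ : InvSystem d X) (x : X) :
    entropy d (nbhds C₀) μ.cramer x ≤ 0 := by
  obtain ⟨C, hC, -⟩ := exists_mem_subset_of_mem_nhds hX univ_mem
  refine (entropy_le_liminf _ hC x).trans ?_
  exact liminf_le_of_frequently_le
    (Eventually.frequently (Eventually.of_forall (logRate_nonpos μ _))) (by isBoundedDefault)

lemma coe_add_entropy_le_pressure (hX : IsMeasurableLCS C₀) (μ : InvSystem d X) (l : X →L[ℝ] ℝ)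
    (x : X) : ((l x : ℝ) : EReal) + entropy d (nbhds C₀) μ.cramer x ≤ pressure d μ.cramer l := by
  have hl := hX.dual_measurable l
  refine le_of_forall_coe_lt fun r hr => ?_
  obtain ⟨a, ha1, ha2⟩ : ∃ a : ℝ, r - l x < a ∧ (a : EReal) < entropy d (nbhds C₀) μ.cramer x := by
    have : ((r - l x : ℝ) : EReal) < entropy d (nbhds C₀) μ.cramer x := by
      rw [EReal.coe_sub]
      refine EReal.sub_lt_of_lt_add' ?_
      exact hr
    obtain ⟨a, h1, h2⟩ := EReal.lt_iff_exists_real_btwn.1 this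
    exact ⟨a, by exact_mod_cast h1, h2⟩
  obtain ⟨C, hC, hCl⟩ := exists_mem_abs_lt hX l (show 0 < a - (r - l x) by linarith)
  have hxC := measurableSet_vadd hX.stable (hX.internal C hC).2 x
  refine le_limsup_of_frequently_le (Eventually.frequently ?_) (by isBoundedDefault)
  filter_upwards [eventually_lt_of_lt_liminf (ha2.trans_le (entropy_le_liminf _ hC x))
    (by isBoundedDefault)] with n hn
  have hn0 : 0 < (n : ℕ) ^ d := by have := n.pos; positivity
  rw [logRate_eq] at hn
  have h1 := (coe_le_log_div_iff hn0 _ _).1 hn.le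
  rw [logLaplace_eq, coe_le_log_div_iff hn0, laplace]
  calc ENNReal.ofReal (Real.exp (r * ((n : ℕ) ^ d : ℕ)))
      = ENNReal.ofReal (Real.exp (((n : ℕ) : ℝ) ^ d * (r - a))) *
        ENNReal.ofReal (Real.exp (a * ((n : ℕ) ^ d : ℕ))) := by
        rw [← ENNReal.ofReal_mul (Real.exp_pos _).le, ← Real.exp_add]
        congr 2
        push_cast
        ring
    _ ≤ ENNReal.ofReal (Real.exp (((n : ℕ) : ℝ) ^ d * (r - a))) * μ.cramer n (x +ᵥ C) := by gcongr
    _ = ∫⁻ _ in x +ᵥ C, ENNReal.ofReal (Real.exp (((n : ℕ) : ℝ) ^ d * (r - a))) ∂(μ.cramer n) := by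
        rw [setLIntegral_const]
    _ ≤ ∫⁻ y in x +ᵥ C, ENNReal.ofReal (Real.exp (((n : ℕ) : ℝ) ^ d * l y)) ∂(μ.cramer n) := by
        refine setLIntegral_mono' hxC fun y hy => ?_
        obtain ⟨z, hz, rfl⟩ := hy
        have := (abs_lt.1 (hCl z hz)).1
        gcongr
        simp only [vadd_eq_add, map_add]
        linarith
    _ ≤ _ := setLIntegral_le_lintegral _ _

lemma coe_le_pressure_sub_entropy (hX : IsMeasurableLCS C₀) (hctl : μ.LocallyControlled)
    (l : X →L[ℝ] ℝ) (x : X) :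
    ((l x : ℝ) : EReal) ≤ pressure d μ.cramer l - entropy d (nbhds C₀) μ.cramer x := by
  have h1 := coe_add_entropy_le_pressure hX μ l x
  have h2 := bot_lt_pressure hX.stable hctl (hX.dual_measurable l)
  have h3 := entropy_nonpos hX μ x
  induction hs : entropy d (nbhds C₀) μ.cramer x with
  | bot => simp [EReal.sub_bot h2.ne']
  | top => simp [hs] at h3
  | coe s =>
    rw [hs] at h1
    exact EReal.le_sub_iff_add_le (by simp) (by simp) |>.2 h1

end Pressure

/-! ### Weak large deviation principles -/

section LargeDeviations

lemma eventually_mul_exp_le {d : ℕ} (hd : 0 < d) (M : ℕ) {a b : ℝ} (hab : a < b) :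
    ∀ᶠ n : ℕ+ in atTop, (M : ℝ≥0∞) * ENNReal.ofReal (Real.exp (a * ((n : ℕ) ^ d : ℕ))) ≤
      ENNReal.ofReal (Real.exp (b * ((n : ℕ) ^ d : ℕ))) := by
  have h1 : Tendsto (fun n : ℕ+ => Real.exp ((b - a) * ((n : ℕ) : ℝ) ^ d)) atTop atTop :=
    Real.tendsto_exp_atTop.comp <| Tendsto.const_mul_atTop (by linarith) <|
      (tendsto_pow_atTop hd.ne').comp <|
        tendsto_natCast_atTop_atTop.comp tendsto_PNat_val_atTop_atTop
  filter_upwards [h1.eventually_ge_atTop (M : ℝ)] with n hn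
  rw [← ENNReal.ofReal_natCast, ← ENNReal.ofReal_mul (by positivity)]
  refine ENNReal.ofReal_le_ofReal ?_
  calc (M : ℝ) * Real.exp (a * ((n : ℕ) ^ d : ℕ))
      ≤ Real.exp ((b - a) * ((n : ℕ) : ℝ) ^ d) * Real.exp (a * ((n : ℕ) ^ d : ℕ)) := by gcongr
    _ = _ := by
      rw [← Real.exp_add]
      congr 1
      push_cast
      ring

/-- A measure is carried by a possibly non-measurable set. -/
def MeasureCarriedBy {E : Type*} {mE : MeasurableSpace E} (ν : Measure E) (D : Set E) : Prop :=
  ∀ A B : Set E, MeasurableSet A → MeasurableSet B → A ∩ D = B ∩ D → ν A = ν B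

lemma MeasureCarriedBy.mono {E : Type*} {mE : MeasurableSpace E} {ν : Measure E} {D : Set E}
    (h : MeasureCarriedBy ν D) {A B : Set E} (hA : MeasurableSet A) (hB : MeasurableSet B)
    (hAB : A ∩ D ⊆ B) : ν A ≤ ν B := by
  have : ν (A ∪ B) = ν B := h _ _ (hA.union hB) hB (by
    rw [union_inter_distrib_right, union_eq_right]
    exact subset_inter hAB inter_subset_right)
  exact (measure_mono subset_union_left).trans_eq this

variable {E : Type*} [MeasurableSpace E]

lemma traceMeasure_preimage {ν : Measure E} {D : Set E} (hν : MeasureCarriedBy ν D) {B : Set E}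
    (hB : MeasurableSet B) : traceMeasure ν D (Subtype.val ⁻¹' B) = ν B := by
  rw [traceMeasure, toMeasure_apply _ _ (measurable_subtype_coe hB), OuterMeasure.comap_apply,
    Measure.coe_toOuterMeasure, Subtype.image_preimage_coe]
  refine le_antisymm (measure_mono inter_subset_right) ?_
  rw [← measure_toMeasurable (D ∩ B)]
  refine hν.mono hB (measurableSet_toMeasurable _ _) ?_
  rw [inter_comm]
  exact subset_toMeasurable _ _

variable [TopologicalSpace E] {d : ℕ}

lemma lowerBound_of_nhds {N : E → Set (Set E)} (hN : ∀ x, ∀ U ∈ 𝓝 x, ∃ V ∈ N x, V ⊆ U)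
    (ν : ℕ+ → Measure E) : LowerBound d ν (entropy d N ν) := by
  intro A _
  refine iSup₂_le fun x hx => ?_
  obtain ⟨V, hV, hVA⟩ := hN x A (mem_interior_iff_mem_nhds.1 hx)
  refine (iInf₂_le V hV).trans (liminf_le_liminf (Eventually.of_forall fun n => ?_))
  exact EReal.div_le_div_right_of_nonneg (by positivity)
    (ENNReal.log_monotone (measure_mono hVA))

lemma limsup_logRate_le_iSup_entropy (hd : 0 < d) {N : E → Set (Set E)} {ν : ℕ+ → Measure E}
    {D K T : Set E} (hν : ∀ n, MeasureCarriedBy (ν n) D) (hK : MeasurableSet K) (hT : IsCompact T)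
    (hKT : K ∩ D ⊆ T) (hN : ∀ x ∈ T, ∀ U ∈ N x, ∃ V ∈ 𝓝 x, MeasurableSet V ∧
      limsup (logRate d ν V) atTop ≤ liminf (logRate d ν U) atTop) :
    limsup (logRate d ν K) atTop ≤ ⨆ x ∈ T, entropy d N ν x := by
  refine le_of_forall_lt_coe fun r hr => ?_
  obtain ⟨r', hr1, hr2⟩ := EReal.lt_iff_exists_real_btwn.1 hr
  have h1 : ∀ x ∈ T, ∃ V ∈ 𝓝 x, MeasurableSet V ∧ limsup (logRate d ν V) atTop < r' := by
    intro x hx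
    have : entropy d N ν x < r' := (le_iSup₂ (f := fun x (_ : x ∈ T) => entropy d N ν x) x
      hx).trans_lt hr1
    obtain ⟨U, hU⟩ := iInf_lt_iff.1 this
    obtain ⟨hUN, hU⟩ := iInf_lt_iff.1 hU
    obtain ⟨V, hV, hVm, hVU⟩ := hN x hx U hUN
    exact ⟨V, hV, hVm, hVU.trans_lt hU⟩
  choose V hV hVm hVr using h1
  obtain ⟨t, ht⟩ := hT.elim_nhds_subcover' V hV
  have h2 : ∀ᶠ n in atTop, ∀ x ∈ t, logRate d ν (V x x.2) n < r' :=
    (Finset.eventually_all t).2 fun x _ => eventually_lt_of_limsup_lt (hVr x x.2)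
      (by isBoundedDefault)
  refine limsup_le_of_le (by isBoundedDefault) ?_
  filter_upwards [h2, eventually_mul_exp_le hd t.card (EReal.coe_lt_coe_iff.1 hr2)] with n hn hn'
  have hn0 : 0 < (n : ℕ) ^ d := by have := n.pos; positivity
  rw [logRate_eq, log_div_le_coe_iff hn0]
  refine le_trans ?_ hn'
  calc ν n K ≤ ν n (⋃ x ∈ t, V x x.2) :=
        (hν n).mono hK (Finset.measurableSet_biUnion _ fun x _ => hVm x x.2) (hKT.trans ht)
    _ ≤ ∑ x ∈ t, ν n (V x x.2) := measure_biUnion_finset_le _ _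
    _ ≤ ∑ x ∈ t, ENNReal.ofReal (Real.exp (r' * ((n : ℕ) ^ d : ℕ))) := by
        refine Finset.sum_le_sum fun x hx => ?_
        have := hn x hx
        rw [logRate_eq] at this
        exact (log_div_le_coe_iff hn0 _ _).1 this.le
    _ = _ := by rw [Finset.sum_const, nsmul_eq_mul]

end LargeDeviations

section Fields

variable {X : Type*} [AddCommGroup X] [Module ℝ X] [MeasurableSpace X] {d : ℕ}
  {μ : InvSystem d X} {g c : ℕ+ → ℝ}

lemma measureCarriedBy_cramer {D : Set X} (hD : Convex ℝ D)
    (hμD : μ.CarriedBy {σ | ∀ z, σ z ∈ D}) (n : ℕ+) : MeasureCarriedBy (μ.cramer n) D := by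
  intro A B hA hB hAB
  rw [μ.cramer_apply hA, μ.cramer_apply hB]
  refine hμD _ _ _ (measurable_mean subset_rfl hA) (measurable_mean subset_rfl hB) ?_
  ext σ
  simp only [mem_inter_iff, mem_preimage, mem_ofPred_eq, and_congr_left_iff]
  intro hσ
  have hm := mean_mem hD (Box.std d n) fun z _ => hσ z
  have := Set.ext_iff.1 hAB (mean (Box.std d n) σ)
  simpa [hm] using this

lemma logRate_traceMeasure {D : Set X} (hν : ∀ n, MeasureCarriedBy (μ.cramer n) D) {B : Set X}
    (hB : MeasurableSet B) :
    logRate d (fun n => traceMeasure (μ.cramer n) D) (Subtype.val ⁻¹' B) =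
      logRate d μ.cramer B := by
  funext n
  rw [logRate, logRate, traceMeasure_preimage (hν n) hB]

variable [TopologicalSpace X] {C₀ : Set (Set X)}

lemma vadd_mem_nhds (hX : IsMeasurableLCS C₀) {C : Set X} (hC : C ∈ C₀) (x : X) :
    x +ᵥ C ∈ 𝓝 x := by
  have := hX.topAddGroup
  have h0 : C ∈ 𝓝 (0 : X) := hX.basis.mem_of_mem hC
  simpa using vadd_mem_nhds_vadd x h0

lemma exists_nbhds_subset (hX : IsMeasurableLCS C₀) {x : X} {U : Set X} (hU : U ∈ 𝓝 x) :
    ∃ V ∈ nbhds C₀ x, V ⊆ U := by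
  have := hX.topAddGroup
  have h0 : (fun y => x + y) ⁻¹' U ∈ 𝓝 (0 : X) :=
    (continuous_const_add x).continuousAt.preimage_mem_nhds (by simpa using hU)
  obtain ⟨C, hC, hCU⟩ := exists_mem_subset_of_mem_nhds hX h0
  refine ⟨x +ᵥ C, ⟨C, hC, rfl⟩, ?_⟩
  rintro _ ⟨y, hy, rfl⟩
  exact hCU hy

lemma Decoupling.exists_nhds_limsup_le (hd : 0 < d) (h : Decoupling μ g c)
    (hX : IsMeasurableLCS C₀) (hctl : μ.LocallyControlled) (x : X) :
    ∀ U ∈ nbhds C₀ x, ∃ V ∈ 𝓝 x, MeasurableSet V ∧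
      limsup (logRate d μ.cramer V) atTop ≤ liminf (logRate d μ.cramer U) atTop := by
  rintro U ⟨C, hC, rfl⟩
  have hC' : (2⁻¹ : ℝ) • C ∈ C₀ := hX.dilation_mem _ (by norm_num) C hC
  exact ⟨x +ᵥ (2⁻¹ : ℝ) • C, vadd_mem_nhds hX hC' x,
    measurableSet_vadd hX.stable (hX.internal _ hC').2 x,
    h.limsup_logRate_le hd hX.stable hctl (hX.internal C hC) x⟩

lemma Decoupling.weakUpperBound (hd : 0 < d) (h : Decoupling μ g c) (hX : IsMeasurableLCS C₀)
    (hctl : μ.LocallyControlled) {D : Set X} (hD : Convex ℝ D)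
    (hμD : μ.CarriedBy {σ | ∀ z, σ z ∈ D}) :
    WeakUpperBound d D μ.cramer (entropy d (nbhds C₀) μ.cramer) := fun _ hK hKD =>
  (limsup_logRate_le_iSup_entropy hd (measureCarriedBy_cramer hD hμD) hK hKD subset_closure
    fun x _ => h.exists_nhds_limsup_le hd hX hctl x).trans
    (biSup_mono fun _ hx => closure_mono inter_subset_left hx)

lemma Decoupling.weakLDP (hd : 0 < d) (h : Decoupling μ g c) (hX : IsMeasurableLCS C₀)
    (hctl : μ.LocallyControlled) : WeakLDP d μ.cramer (entropy d (nbhds C₀) μ.cramer) :=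
  ⟨lowerBound_of_nhds (fun _ _ hU => exists_nbhds_subset hX hU) _,
    h.weakUpperBound hd hX hctl convex_univ fun _ A B _ _ hAB => by
      simp only [mem_univ, implies_true, ofPred_true, inter_univ] at hAB
      rw [hAB]⟩

lemma Decoupling.weakLDP_trace (hd : 0 < d) (h : Decoupling μ g c) (hX : IsMeasurableLCS C₀)
    (hctl : μ.LocallyControlled) {D : Set X} (hD : Convex ℝ D)
    (hμD : μ.CarriedBy {σ | ∀ z, σ z ∈ D}) :
    WeakLDP d (fun n => traceMeasure (μ.cramer n) D)
      (entropy d (nbhdsIn C₀ D) (fun n => traceMeasure (μ.cramer n) D)) := by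
  have hν := measureCarriedBy_cramer hD hμD
  refine ⟨lowerBound_of_nhds (fun x U hU => ?_) _, fun K hK hKD => ?_⟩
  · obtain ⟨W, hW, hWU⟩ := mem_nhds_subtype D x U |>.1 hU
    obtain ⟨V, hV, hVW⟩ := exists_nbhds_subset hX hW
    exact ⟨_, ⟨V, hV, rfl⟩, (preimage_mono hVW).trans hWU⟩
  · rw [inter_univ] at hKD
    refine limsup_logRate_le_iSup_entropy (D := univ) hd (fun n A B _ _ hAB => ?_) hK hKD
      (inter_subset_left.trans subset_closure) fun x _ => ?_
    · simp only [inter_univ] at hAB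
      rw [hAB]
    · rintro _ ⟨U, hU, rfl⟩
      obtain ⟨V, hV, hVm, hVU⟩ := h.exists_nhds_limsup_le hd hX hctl (x : X) U hU
      obtain ⟨C, hC, rfl⟩ := hU
      refine ⟨Subtype.val ⁻¹' V, continuous_subtype_val.continuousAt.preimage_mem_nhds hV,
        measurable_subtype_coe hVm, ?_⟩
      rwa [logRate_traceMeasure hν hVm, logRate_traceMeasure hν
        (measurableSet_vadd hX.stable (hX.internal C hC).2 _)]

end Fields

/-! ### Pressure as a supremum, under convex tightness -/

lemma lintegral_biUnion_finset_le {α ι : Type*} {mα : MeasurableSpace α} (ν : Measure α)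
    (t : Finset ι) (s : ι → Set α) (f : α → ℝ≥0∞) :
    ∫⁻ x in ⋃ i ∈ t, s i, f x ∂ν ≤ ∑ i ∈ t, ∫⁻ x in s i, f x ∂ν := by
  classical
  induction t using Finset.induction_on with
  | empty => simp
  | insert i t hi ih =>
    rw [Finset.set_biUnion_insert, Finset.sum_insert hi]
    exact (lintegral_union_le _ _ _).trans (by gcongr)

/-- A mean of points of two convex sets lies in the set of their convex combinations. -/
lemma mem_union_image_of_sum_eq {X : Type*} [AddCommGroup X] [Module ℝ X] {A B : Set X}
    (hA : Convex ℝ A) (hB : Convex ℝ B) {ι κ : Type*} {I : Finset ι} (hI : I.Nonempty)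
    (G : Finset κ) {V N : ℝ} (hV : 0 < V) (hcount : V * I.card + G.card = N) {M : X}
    {a : ι → X} {b : κ → X} (hsum : N • M = ∑ i ∈ I, V • a i + ∑ z ∈ G, b z)
    (ha : ∀ i ∈ I, a i ∈ A) (hb : ∀ z ∈ G, b z ∈ B) :
    M ∈ A ∪ (fun p : ℝ × X × X => p.1 • p.2.1 + (1 - p.1) • p.2.2) '' (Icc 0 1 ×ˢ A ×ˢ B) := by
  have hI0 : (0 : ℝ) < I.card := by exact_mod_cast hI.card_pos
  have hN : 0 < N := by rw [← hcount]; positivity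
  have ha' : (I.card : ℝ)⁻¹ • ∑ i ∈ I, a i ∈ A := by
    rw [Finset.smul_sum]
    refine hA.sum_mem (fun _ _ => by positivity) ?_ ha
    rw [Finset.sum_const, nsmul_eq_mul, mul_inv_cancel₀ hI0.ne']
  have hM : M = N⁻¹ • (V • ∑ i ∈ I, a i + ∑ z ∈ G, b z) := by
    rw [eq_inv_smul_iff₀ hN.ne', hsum, Finset.smul_sum]
  rcases G.eq_empty_or_nonempty with rfl | hG
  · left
    have : M = (I.card : ℝ)⁻¹ • ∑ i ∈ I, a i := by
      rw [hM, Finset.sum_empty, add_zero, smul_smul, ← hcount]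
      congr 1
      simp only [Finset.card_empty, Nat.cast_zero, add_zero]
      field_simp
    rwa [this]
  · right
    have hG0 : (0 : ℝ) < G.card := by exact_mod_cast hG.card_pos
    have hb' : (G.card : ℝ)⁻¹ • ∑ z ∈ G, b z ∈ B := by
      rw [Finset.smul_sum]
      refine hB.sum_mem (fun _ _ => by positivity) ?_ hb
      rw [Finset.sum_const, nsmul_eq_mul, mul_inv_cancel₀ hG0.ne']
    refine ⟨(V * I.card / N, _, _), ⟨⟨by positivity, ?_⟩, ha', hb'⟩, ?_⟩
    · exact div_le_one_of_le₀ (by linarith) hN.le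
    · have h1 : 1 - V * I.card / N = G.card / N := by
        field_simp
        linarith
      simp only [h1]
      rw [hM, smul_smul, smul_smul, smul_add, smul_smul]
      congr 2 <;> field_simp

lemma exists_neg_le_of_isCompact_closure {X : Type*} [AddCommGroup X] [Module ℝ X]
    [TopologicalSpace X] (l : X →L[ℝ] ℝ) {K : Set X}
    (hK : IsCompact (closure K)) : ∃ b : ℝ, ∀ x ∈ K, -b ≤ l x := by
  obtain ⟨b, hb⟩ := (hK.image l.continuous).bddBelow
  exact ⟨-b, fun x hx => by simpa using hb (mem_image_of_mem l (subset_closure hx))⟩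

section Tightness

variable {X : Type*} [AddCommGroup X] [Module ℝ X] [MeasurableSpace X] {d : ℕ}
  {μ : InvSystem d X} {g c : ℕ+ → ℝ} {D : Set X}

lemma ae_mem_of_carriedBy {E : Set (Config d X)} (hμ : μ.CarriedBy E) (L : Box d)
    {G : Set (Config d X)} (hG : MeasurableSet[algebra X L.sites] G) (hEG : E ⊆ G) :
    ∀ᵐ σ ∂(μ.law L), σ ∈ G := by
  have h := hμ L Gᶜ ∅ hG.compl (@MeasurableSet.empty _ (algebra X L.sites)) (by
    ext σ
    simpa using fun h1 h2 => h1 (hEG h2))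
  rw [measure_empty] at h
  exact h

lemma measure_compl_le_of_siteBound (hμD : μ.CarriedBy {σ | ∀ z, σ z ∈ D})
    {K : Set X} (hK : MeasurableSet K) (hKD : Convex ℝ (K ∩ D)) {γ : ℝ}
    (hγ1 : γ ≤ 1) (hs : μ.SiteBound (1 - γ) K) (m : ℕ+) :
    μ.cramer m Kᶜ ≤ ENNReal.ofReal (((m : ℕ) ^ d : ℕ) * γ) := by
  have := μ.isProbabilityMeasure_cramer m
  have h1 := hs.lintegral_le hK (L := Box.std d m) (S := ∅) (G := (Box.std d m).sites)
    (Finset.empty_subset _) subset_rfl (Finset.disjoint_empty_left _) (f := fun _ => 1)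
    measurable_const
  rw [lintegral_const, μ.prob, Box.card_std, mul_one, mul_one] at h1
  set S : Set (Config d X) := ⋂ z ∈ (Box.std d m).sites, (fun σ : Config d X => σ z) ⁻¹' K with hS
  have hSm : MeasurableSet[algebra X (Box.std d m).sites] S :=
    MeasurableSet.biInter (Finset.countable_toSet _) fun z hz => measurable_site hz hK
  have h2 : ∫⁻ σ, 1 * ∏ z ∈ (Box.std d m).sites, K.indicator 1 (σ z) ∂(μ.law (Box.std d m)) ≤
      μ.law (Box.std d m) S := by
    rw [← lintegral_indicator_one hSm]
    refine lintegral_mono fun σ => ?_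
    by_cases hσ : σ ∈ S
    · rw [indicator_of_mem hσ, one_mul]
      exact Finset.prod_le_one' fun z _ => indicator_le_self' (by simp) _
    · simp only [hS, mem_iInter, not_forall] at hσ
      obtain ⟨z, hz, hzσ⟩ := hσ
      rw [Finset.prod_eq_zero hz (indicator_of_notMem (show σ z ∉ K from hzσ) _)]
      simp
  have h3 : μ.law (Box.std d m) S ≤ μ.cramer m K := by
    rw [μ.cramer_apply hK]
    refine MeasureCarriedBy.mono (D := {σ | ∀ z, σ z ∈ D}) (fun A B hA hB hAB =>
      hμD _ A B hA hB hAB) hSm (measurable_mean subset_rfl hK) ?_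
    rintro σ ⟨hσ, hσD⟩
    simp only [hS, mem_iInter] at hσ
    exact (mean_mem hKD _ fun z hz => ⟨hσ z hz, hσD z⟩).1
  have h4 : ENNReal.ofReal (1 - ((m : ℕ) ^ d : ℕ) * γ) ≤ μ.cramer m K := by
    refine le_trans ?_ (h1.trans (h2.trans h3))
    rw [← ENNReal.ofReal_pow (by linarith)]
    refine ENNReal.ofReal_le_ofReal ?_
    have := one_add_mul_le_pow (a := -γ) (by linarith) ((m : ℕ) ^ d)
    calc _ = _ := by ring
      _ ≤ _ := this
      _ = _ := by ring
  rw [prob_compl_eq_one_sub hK]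
  refine tsub_le_iff_right.2 ?_
  calc (1 : ℝ≥0∞) = ENNReal.ofReal (((m : ℕ) ^ d : ℕ) * γ + (1 - ((m : ℕ) ^ d : ℕ) * γ)) := by simp
    _ ≤ _ := ENNReal.ofReal_add_le
    _ ≤ _ := by gcongr

variable [TopologicalSpace X]

lemma exists_compact_convex_le_setLIntegral
    (hμD : μ.CarriedBy {σ | ∀ z, σ z ∈ D}) (hT : μ.LocallyConvexTight D) (m : ℕ+) {f : X → ℝ≥0}
    {r : ℝ≥0∞} (hr : r < ∫⁻ x, f x ∂(μ.cramer m)) :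
    ∃ K : Set X, MeasurableSet K ∧ Convex ℝ (K ∩ D) ∧ IsCompact (closure (K ∩ D)) ∧
      r ≤ ∫⁻ x in K, f x ∂(μ.cramer m) := by
  have := μ.isProbabilityMeasure_cramer m
  obtain ⟨φ, hφf, hφ, hrφ⟩ := exists_lt_lintegral_simpleFunc_of_lt_lintegral hr
  obtain ⟨δ, hδ, hδφ⟩ := exists_pos_setLIntegral_lt_of_measure_lt hφ.ne (tsub_pos_of_lt hrφ).ne'
  obtain ⟨δ', hδ'0, hδ'⟩ : ∃ δ' : ℝ, 0 < δ' ∧ ENNReal.ofReal δ' < δ := by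
    obtain ⟨e, he0, he⟩ := ENNReal.lt_iff_exists_nnreal_btwn.1 hδ
    exact ⟨e, by exact_mod_cast he0, by simpa using he⟩
  have hv : (0 : ℝ) < ((m : ℕ) ^ d : ℕ) := by
    have := m.pos
    positivity
  set γ : ℝ := min 1 (δ' / ((m : ℕ) ^ d : ℕ)) with hγ
  have hγ0 : 0 < γ := by positivity
  obtain ⟨K, hK, hKD, hKc, hs⟩ := hT γ hγ0
  refine ⟨K, hK, hKD, hKc, ?_⟩
  have h1 : μ.cramer m Kᶜ < δ := by
    refine (measure_compl_le_of_siteBound hμD hK hKD (min_le_left _ _) hs m).trans_lt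
      (lt_of_le_of_lt (ENNReal.ofReal_le_ofReal ?_) hδ')
    have : γ ≤ δ' / ((m : ℕ) ^ d : ℕ) := min_le_right _ _
    rwa [le_div_iff₀' hv] at this
  have h2 := hδφ _ h1
  have h3 := lintegral_add_compl (μ := μ.cramer m) (fun x => (φ x : ℝ≥0∞)) hK
  have h4 : ∫⁻ x in K, φ x ∂(μ.cramer m) ≤ ∫⁻ x in K, f x ∂(μ.cramer m) :=
    lintegral_mono fun x => ENNReal.coe_le_coe.2 (hφf x)
  refine le_trans ?_ h4
  by_contra! hlt
  refine lt_irrefl (∫⁻ x, φ x ∂(μ.cramer m)) ?_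
  calc ∫⁻ x, φ x ∂(μ.cramer m) = _ := h3.symm
    _ < r + (∫⁻ x, φ x ∂(μ.cramer m) - r) := ENNReal.add_lt_add hlt h2
    _ = _ := add_tsub_cancel_of_le hrφ.le

variable {C₀ : Set (Set X)}

lemma Decoupling.exists_nhds_setLIntegral_le (hd : 0 < d) (h : Decoupling μ g c)
    (hX : IsMeasurableLCS C₀) (hctl : μ.LocallyControlled) (l : X →L[ℝ] ℝ) {b : ℝ} {x : X}
    (hx : ((l x : ℝ) : EReal) + entropy d (nbhds C₀) μ.cramer x < b) :
    ∃ V ∈ 𝓝 x, MeasurableSet V ∧ ∀ᶠ N : ℕ+ in atTop,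
      ∫⁻ y in V, ENNReal.ofReal (Real.exp (((N : ℕ) : ℝ) ^ d * l y)) ∂(μ.cramer N) ≤
        ENNReal.ofReal (Real.exp (b * ((N : ℕ) ^ d : ℕ))) := by
  have hx' : entropy d (nbhds C₀) μ.cramer x < ((b - l x : ℝ) : EReal) := by
    rw [EReal.coe_sub]
    refine (EReal.lt_sub_iff_add_lt (by simp) (by simp)).2 ?_
    rwa [add_comm]
  obtain ⟨a, ha1, ha2⟩ := EReal.lt_iff_exists_real_btwn.1 hx'
  have ha2' : a < b - l x := by exact_mod_cast ha2
  obtain ⟨U, hU⟩ := iInf_lt_iff.1 ha1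
  obtain ⟨hUN, hU⟩ := iInf_lt_iff.1 hU
  obtain ⟨V, hV, hVm, hVU⟩ := h.exists_nhds_limsup_le hd hX hctl x U hUN
  obtain ⟨C, hC, hCl⟩ := exists_mem_abs_lt hX l (show 0 < b - l x - a by linarith)
  have hxC := measurableSet_vadd hX.stable (hX.internal C hC).2 x
  refine ⟨V ∩ (x +ᵥ C), inter_mem hV (vadd_mem_nhds hX hC x), hVm.inter hxC, ?_⟩
  filter_upwards [eventually_lt_of_limsup_lt (hVU.trans_lt hU) (by isBoundedDefault)] with N hN
  have hn0 : 0 < (N : ℕ) ^ d := by have := N.pos; positivity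
  rw [logRate_eq] at hN
  have h1 := (log_div_le_coe_iff hn0 _ _).1 hN.le
  calc ∫⁻ y in V ∩ (x +ᵥ C), ENNReal.ofReal (Real.exp (((N : ℕ) : ℝ) ^ d * l y)) ∂(μ.cramer N)
      ≤ ∫⁻ _ in V ∩ (x +ᵥ C), ENNReal.ofReal (Real.exp (((N : ℕ) : ℝ) ^ d * (b - a)))
          ∂(μ.cramer N) := by
        refine setLIntegral_mono' (hVm.inter hxC) fun y hy => ?_
        obtain ⟨z, hz, rfl⟩ := hy.2
        have := (abs_lt.1 (hCl z hz)).2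
        gcongr
        simp only [vadd_eq_add, map_add]
        linarith
    _ = ENNReal.ofReal (Real.exp (((N : ℕ) : ℝ) ^ d * (b - a))) * μ.cramer N (V ∩ (x +ᵥ C)) := by
        rw [setLIntegral_const]
    _ ≤ ENNReal.ofReal (Real.exp (((N : ℕ) : ℝ) ^ d * (b - a))) *
          ENNReal.ofReal (Real.exp (a * ((N : ℕ) ^ d : ℕ))) := by
        gcongr
        exact (measure_mono inter_subset_left).trans h1
    _ = _ := by
        rw [← ENNReal.ofReal_mul (Real.exp_pos _).le, ← Real.exp_add]
        congr 2
        push_cast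
        ring

lemma Decoupling.eventually_tiling_le (hd : 0 < d) (h : Decoupling μ g c)
    (hX : IsMeasurableLCS C₀) (hctl : μ.LocallyControlled) (hD : Convex ℝ D)
    (hμD : μ.CarriedBy {σ | ∀ z, σ z ∈ D}) (l : X →L[ℝ] ℝ) {b₁ b₂ : ℝ} (hb : b₁ < b₂)
    (hsup : ∀ x, ((l x : ℝ) : EReal) + entropy d (nbhds C₀) μ.cramer x < b₁)
    {K₀ : Set X} (hK₀ : MeasurableSet K₀) (hK₀D : Convex ℝ (K₀ ∩ D))
    (hK₀c : IsCompact (closure (K₀ ∩ D))) {α β : ℝ} (hα : 0 < α) (hs : μ.SiteBound α K₀)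
    (hβ : ∀ x ∈ K₀ ∩ D, -β ≤ l x) {K : Set X} (hK : MeasurableSet K) (hKD : Convex ℝ (K ∩ D))
    (hKc : IsCompact (closure (K ∩ D))) (m : ℕ+) :
    ∀ᶠ N : ℕ+ in atTop, ∀ k : ℕ, 0 < k → k * period g m ≤ N →
      (ENNReal.ofReal (Real.exp (-c m)) *
        ∫⁻ x in K, ENNReal.ofReal (Real.exp (((m : ℕ) : ℝ) ^ d * l x)) ∂(μ.cramer m)) ^ k ^ d *
        ENNReal.ofReal (α * Real.exp (-β)) ^ ((N : ℕ) ^ d - (k * m) ^ d) ≤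
        ENNReal.ofReal (Real.exp (b₂ * ((N : ℕ) ^ d : ℕ))) := by
  classical
  have := hX.topAddGroup
  have := hX.continuousSMul
  have hl := hX.dual_measurable l
  set T : Set X := closure (K ∩ D) ∪ (fun p : ℝ × X × X => p.1 • p.2.1 + (1 - p.1) • p.2.2) ''
    (Icc 0 1 ×ˢ closure (K ∩ D) ×ˢ closure (K₀ ∩ D)) with hT
  have hTc : IsCompact T :=
    hKc.union ((isCompact_Icc.prod (hKc.prod hK₀c)).image (by fun_prop))
  choose V hV hVm hVl using fun x => h.exists_nhds_setLIntegral_le hd hX hctl l (hsup x)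
  obtain ⟨t, -, ht⟩ := hTc.elim_nhds_subcover V fun x _ => hV x
  have hev : ∀ᶠ N : ℕ+ in atTop, ∀ x ∈ t,
      ∫⁻ y in V x, ENNReal.ofReal (Real.exp (((N : ℕ) : ℝ) ^ d * l y)) ∂(μ.cramer N) ≤
        ENNReal.ofReal (Real.exp (b₁ * ((N : ℕ) ^ d : ℕ))) :=
    (Finset.eventually_all t).2 fun x _ => hVl x
  set W : Set X := ⋃ x ∈ t, V x with hW
  have hWm : MeasurableSet W := Finset.measurableSet_biUnion _ fun x _ => hVm x
  filter_upwards [hev, eventually_mul_exp_le hd t.card hb] with N hN1 hN2 k hk hkN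
  have key := h.le.tiling_lintegral_le h.nonneg hK₀ hs hkN
    (fun _ => K.indicator fun x => ENNReal.ofReal (Real.exp (((m : ℕ) : ℝ) ^ d * l x)))
    (fun _ => (measurable_exp_mul hl _).indicator hK)
  rw [Finset.prod_const, Finset.card_univ, Fintype.card_fun, Fintype.card_fin,
    Fintype.card_fin, lintegral_indicator hK] at key
  rw [ENNReal.ofReal_mul hα.le, mul_pow (ENNReal.ofReal α), ← mul_assoc]
  refine (mul_le_mul_left key _).trans ?_
  rw [← lintegral_mul_const' _ _ (by finiteness)]
  set G := gap d m N (period g m) k with hG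
  have hGN : G ⊆ (Box.std d N).sites := Finset.sdiff_subset
  have hcell := fun j : Fin d → Fin k => cell_subset (le_period g m) hkN j
  set good : Set (Config d X) :=
    ((⋂ j : Fin d → Fin k, mean (cell m (period g m) j) ⁻¹' K) ∩
      ⋂ z ∈ G, (fun σ : Config d X => σ z) ⁻¹' K₀)ᶜ ∪
    (mean (Box.std d N) ⁻¹' W ∩ ⋂ z ∈ G, (fun σ : Config d X => σ z) ⁻¹' {x | -β ≤ l x}) with hgood
  have hgm : MeasurableSet[algebra X (Box.std d N).sites] good := by
    refine MeasurableSet.union (MeasurableSet.compl (MeasurableSet.inter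
      (MeasurableSet.iInter fun j => measurable_mean (hcell j) hK)
      (MeasurableSet.biInter (Finset.countable_toSet _) fun z hz => measurable_site (hGN hz) hK₀)))
      (MeasurableSet.inter (measurable_mean subset_rfl hWm)
      (MeasurableSet.biInter (Finset.countable_toSet _) fun z hz => measurable_site (hGN hz) ?_))
    exact measurableSet_le measurable_const hl
  have hgE : {σ : Config d X | ∀ z, σ z ∈ D} ⊆ good := by
    intro σ hσ
    by_cases hσK : σ ∈ (⋂ j : Fin d → Fin k, mean (cell m (period g m) j) ⁻¹' K) ∩
      ⋂ z ∈ G, (fun σ : Config d X => σ z) ⁻¹' K₀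
    swap
    · exact Or.inl hσK
    right
    simp only [mem_inter_iff, mem_iInter, mem_preimage] at hσK ⊢
    refine ⟨ht ?_, fun z hz => hβ _ ⟨hσK.2 z hz, hσ z⟩⟩
    have hmpos : (0 : ℝ) < ((m : ℕ) : ℝ) ^ d := by have := m.pos; positivity
    have hle : (k * m) ^ d ≤ (N : ℕ) ^ d :=
      Nat.pow_le_pow_left ((Nat.mul_le_mul_left k (le_period g m)).trans hkN) d
    have hI : (Finset.univ : Finset (Fin d → Fin k)).Nonempty :=
      ⟨fun _ => ⟨0, hk⟩, Finset.mem_univ _⟩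
    refine mem_union_image_of_sum_eq hKD.closure hK₀D.closure hI G hmpos ?_
      (sum_box_eq h.nonneg hkN σ) (fun j _ => subset_closure ⟨hσK.1 j, mean_mem hD _ fun z _ => hσ z⟩)
      fun z hz => subset_closure ⟨hσK.2 z hz, hσ z⟩
    rw [hG, card_gap h.nonneg hkN, Nat.cast_sub hle, Finset.card_univ]
    simp only [Fintype.card_fun, Fintype.card_fin]
    push_cast
    ring
  calc ∫⁻ σ, (∏ j, K.indicator (fun x => ENNReal.ofReal (Real.exp (((m : ℕ) : ℝ) ^ d * l x)))
          (mean (cell m (period g m) j) σ)) * (∏ z ∈ G, K₀.indicator 1 (σ z)) *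
          ENNReal.ofReal (Real.exp (-β)) ^ ((N : ℕ) ^ d - (k * m) ^ d) ∂(μ.law (Box.std d N))
      ≤ ∫⁻ σ, W.indicator (fun x => ENNReal.ofReal (Real.exp (((N : ℕ) : ℝ) ^ d * l x)))
          (mean (Box.std d N) σ) ∂(μ.law (Box.std d N)) := by
        refine lintegral_mono_ae ?_
        filter_upwards [ae_mem_of_carriedBy hμD _ hgm hgE] with σ hσ
        by_cases hσK : σ ∈ (⋂ j : Fin d → Fin k, mean (cell m (period g m) j) ⁻¹' K) ∩
          ⋂ z ∈ G, (fun σ : Config d X => σ z) ⁻¹' K₀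
        · have hσ' := hσ.resolve_left (not_not_intro hσK)
          simp only [mem_inter_iff, mem_iInter, mem_preimage] at hσK hσ'
          rw [indicator_of_mem hσ'.1, Finset.prod_congr rfl fun j _ => indicator_of_mem (hσK.1 j) _,
            Finset.prod_congr rfl fun z hz => indicator_of_mem (hσK.2 z hz) _]
          simp only [Pi.one_apply, Finset.prod_const_one, mul_one]
          exact prod_exp_mul_le l.toLinearMap h.nonneg hkN hσ'.2
        · simp only [mem_inter_iff, mem_iInter, mem_preimage, not_and_or, not_forall] at hσK
          refine le_of_eq_of_le ?_ zero_le
          rcases hσK with ⟨j, hj⟩ | ⟨z, hz, hzσ⟩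
          · rw [Finset.prod_eq_zero (Finset.mem_univ j) (indicator_of_notMem hj _), zero_mul,
              zero_mul]
          · rw [Finset.prod_eq_zero hz (indicator_of_notMem hzσ _), mul_zero, zero_mul]
    _ = ∫⁻ x in W, ENNReal.ofReal (Real.exp (((N : ℕ) : ℝ) ^ d * l x)) ∂(μ.cramer N) := by
        rw [μ.lintegral_mean_std ((measurable_exp_mul hl _).indicator hWm),
          lintegral_indicator hWm]
    _ ≤ ∑ x ∈ t, ∫⁻ y in V x, ENNReal.ofReal (Real.exp (((N : ℕ) : ℝ) ^ d * l y)) ∂(μ.cramer N) :=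
        lintegral_biUnion_finset_le _ _ _ _
    _ ≤ ∑ x ∈ t, ENNReal.ofReal (Real.exp (b₁ * ((N : ℕ) ^ d : ℕ))) := Finset.sum_le_sum hN1
    _ ≤ _ := by rwa [Finset.sum_const, nsmul_eq_mul]

lemma Decoupling.pressure_le_iSup (hd : 0 < d) (h : Decoupling μ g c)
    (hX : IsMeasurableLCS C₀) (hctl : μ.LocallyControlled) (hD : Convex ℝ D)
    (hμD : μ.CarriedBy {σ | ∀ z, σ z ∈ D}) (hT : μ.LocallyConvexTight D) (l : X →L[ℝ] ℝ) :
    pressure d μ.cramer l ≤ ⨆ x, (((l x : ℝ) : EReal) + entropy d (nbhds C₀) μ.cramer x) := by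
  classical
  by_contra! hlt
  obtain ⟨b₁, h1, h1'⟩ := EReal.lt_iff_exists_real_btwn.1 hlt
  obtain ⟨b₂, h2, h2'⟩ := EReal.lt_iff_exists_real_btwn.1 h1'
  obtain ⟨b₃, h3, h3'⟩ := EReal.lt_iff_exists_real_btwn.1 h2'
  obtain ⟨K₀, hK₀, hK₀D, hK₀c, hs⟩ := hT 2⁻¹ (by norm_num)
  obtain ⟨β, hβ⟩ := exists_neg_le_of_isCompact_closure l hK₀c
  have hv : ∀ n : ℕ+, 0 < (n : ℕ) ^ d := fun n => by have := n.pos; positivity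
  let u : ℕ+ → ℝ≥0∞ := fun m =>
    if ENNReal.ofReal (Real.exp (b₃ * ((m : ℕ) ^ d : ℕ))) < laplace d μ.cramer l m then
      ENNReal.ofReal (Real.exp (b₃ * ((m : ℕ) ^ d : ℕ))) else 0
  have key := limsup_rate_le_liminf_rate h.tendsto_cost (le_period g)
    (tendsto_div_period h.nonneg h.tendsto_gap) u
    (fun n => ENNReal.ofReal (Real.exp (b₂ * ((n : ℕ) ^ d : ℕ))))
    (κ := (1 - 2⁻¹) * Real.exp (-β)) (δ := 1) (by norm_num; positivity) one_pos fun m => by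
      by_cases hm : ENNReal.ofReal (Real.exp (b₃ * ((m : ℕ) ^ d : ℕ))) < laplace d μ.cramer l m
      · obtain ⟨K, hK, hKD, hKc, hKu⟩ := exists_compact_convex_le_setLIntegral hμD hT m hm
        filter_upwards [h.eventually_tiling_le hd hX hctl hD hμD l (EReal.coe_lt_coe_iff.1 h2)
          (fun x => (le_iSup (fun x => ((l x : ℝ) : EReal) + entropy d (nbhds C₀) μ.cramer x)
            x).trans_lt h1) hK₀ hK₀D hK₀c (by norm_num) hs hβ hK hKD hKc m] with N hN k hk _ hkN _
        refine le_trans ?_ (hN k hk hkN)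
        have : u m = ENNReal.ofReal (Real.exp (b₃ * ((m : ℕ) ^ d : ℕ))) := if_pos hm
        rw [this]
        gcongr
        exact hKu
      · refine Eventually.of_forall fun N k hk _ _ _ => ?_
        have : u m = 0 := if_neg hm
        rw [this, mul_zero, zero_pow (pow_pos hk d).ne', zero_mul]
        exact zero_le
  have e1 : (b₃ : EReal) ≤
      limsup (fun n : ℕ+ => ENNReal.log (u n) / (((n : ℕ) ^ d : ℕ) : EReal)) atTop := by
    refine le_limsup_of_frequently_le ?_ (by isBoundedDefault)
    refine (frequently_lt_of_lt_limsup (by isBoundedDefault) h3').mono fun n hn => ?_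
    rw [logLaplace_eq, ← not_le, log_div_le_coe_iff (hv n), not_le] at hn
    rw [coe_le_log_div_iff (hv n)]
    exact (if_pos hn).ge
  have e2 : liminf (fun n : ℕ+ => ENNReal.log (ENNReal.ofReal (Real.exp
      (b₂ * ((n : ℕ) ^ d : ℕ)))) / (((n : ℕ) ^ d : ℕ) : EReal)) atTop ≤ b₂ :=
    liminf_le_of_frequently_le (Eventually.frequently (Eventually.of_forall fun n =>
      (log_div_le_coe_iff (hv n) _ _).2 le_rfl)) (by isBoundedDefault)
  exact absurd (e1.trans (key.trans e2)) (not_le.2 h3)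

end Tightness

/-! ### Concavity of the entropy and duality -/

section Duality

lemma convex_of_isClosed_of_midpoint {E : Type*} [AddCommGroup E] [Module ℝ E] [TopologicalSpace E]
    [IsTopologicalAddGroup E] [ContinuousSMul ℝ E] {H : Set E} (hc : IsClosed H)
    (hm : ∀ x ∈ H, ∀ y ∈ H, (2⁻¹ : ℝ) • (x + y) ∈ H) : Convex ℝ H := by
  intro x hx y hy a b ha hb hab
  set f : ℝ → E := fun θ => (1 - θ) • x + θ • y with hf
  have hfc : Continuous f := by fun_prop
  set Θ : Set ℝ := f ⁻¹' H with hΘ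
  have hΘc : IsClosed Θ := hc.preimage hfc
  have h0 : (0 : ℝ) ∈ Θ := by simpa [hΘ, hf] using hx
  have h1 : (1 : ℝ) ∈ Θ := by simpa [hΘ, hf] using hy
  have hmid : ∀ p ∈ Θ, ∀ q ∈ Θ, (p + q) / 2 ∈ Θ := fun p hp q hq => by
    have := hm _ hp _ hq
    have e : (2⁻¹ : ℝ) • (f p + f q) = f ((p + q) / 2) := by
      simp only [hf]
      module
    rwa [e] at this
  suffices hbΘ : b ∈ Θ by
    have : a = 1 - b := by linarith
    rw [this]
    exact hbΘ
  by_contra hbΘ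
  have hb1 : b ≤ 1 := by linarith
  have hp := (isCompact_Icc.inter_left hΘc).sSup_mem (s := Θ ∩ Icc 0 b) ⟨0, h0, le_rfl, hb⟩
  have hq := (isCompact_Icc.inter_left hΘc).sInf_mem (s := Θ ∩ Icc b 1) ⟨1, h1, hb1, le_rfl⟩
  set p := sSup (Θ ∩ Icc 0 b)
  set q := sInf (Θ ∩ Icc b 1)
  have hpb : p < b := lt_of_le_of_ne hp.2.2 fun e => hbΘ (e ▸ hp.1)
  have hbq : b < q := lt_of_le_of_ne hq.2.1 fun e => hbΘ (e ▸ hq.1)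
  have hpq := hmid p hp.1 q hq.1
  rcases le_total ((p + q) / 2) b with h | h
  · have : (p + q) / 2 ≤ p := le_csSup ⟨b, fun z hz => hz.2.2⟩ ⟨hpq, by linarith [hp.2.1], h⟩
    linarith
  · have : q ≤ (p + q) / 2 := csInf_le ⟨b, fun z hz => hz.2.1⟩ ⟨hpq, h, by linarith [hq.2.2]⟩
    linarith

variable {X : Type*} [AddCommGroup X] [Module ℝ X] [TopologicalSpace X]

/-- The hypograph of an extended real function. -/
def hypograph (s : X → EReal) : Set (X × ℝ) := {p | (p.2 : EReal) ≤ s p.1}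

/-- A concave upper semicontinuous function is the infimum of its affine majorants. -/
lemma iInf_le_of_convex_hypograph [IsTopologicalAddGroup X] [ContinuousSMul ℝ X]
    [LocallyConvexSpace ℝ X] {s : X → EReal} (hs : ∀ x, s x ≠ ⊤) (hne : ∃ x, s x ≠ ⊥)
    (hconv : Convex ℝ (hypograph s)) (hclosed : IsClosed (hypograph s)) {p : (X →L[ℝ] ℝ) → EReal}
    (hp : ∀ l, p l ≤ ⨆ x, (((l x : ℝ) : EReal) + s x)) (x : X) :
    ⨅ l : X →L[ℝ] ℝ, (p l - ((l x : ℝ) : EReal)) ≤ s x := by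
  obtain ⟨y₀, hy₀⟩ := hne
  obtain ⟨s₀, hs₀⟩ : ∃ s₀ : ℝ, s y₀ = s₀ := ⟨(s y₀).toReal, (EReal.coe_toReal (hs y₀) hy₀).symm⟩
  have hsep : ∀ (z : X) (r : ℝ), s z < r → ∃ (φ : X →L[ℝ] ℝ) (c u : ℝ), 0 ≤ c ∧
      (∀ (y : X) (t : ℝ), (t : EReal) ≤ s y → φ y + t * c < u) ∧ u < φ z + r * c := by
    intro z r hz
    obtain ⟨f, u, hfu, huf⟩ := geometric_hahn_banach_closed_point (x := (z, r)) hconv hclosed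
      (by simpa [hypograph] using hz)
    have hf : ∀ (y : X) (t : ℝ), f (y, t) = f.comp (ContinuousLinearMap.inl ℝ X ℝ) y +
        t * f (0, 1) := fun y t => by
      have : ((y, t) : X × ℝ) = (y, 0) + t • ((0, 1) : X × ℝ) := by simp
      rw [this, map_add, map_smul, smul_eq_mul]
      rfl
    have hlt : ∀ (y : X) (t : ℝ), (t : EReal) ≤ s y →
        f.comp (ContinuousLinearMap.inl ℝ X ℝ) y + t * f (0, 1) < u := fun y t ht => by
      rw [← hf]
      exact hfu _ ht
    refine ⟨f.comp (ContinuousLinearMap.inl ℝ X ℝ), f (0, 1), u, ?_, hlt, by rwa [← hf]⟩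
    by_contra! hc
    set φ := f.comp (ContinuousLinearMap.inl ℝ X ℝ)
    have h1 := hlt y₀ (min s₀ ((u - φ y₀) / f (0, 1))) (by
      rw [hs₀]
      exact_mod_cast min_le_left _ _)
    have h2 : (u - φ y₀) / f (0, 1) * f (0, 1) ≤ min s₀ ((u - φ y₀) / f (0, 1)) * f (0, 1) :=
      mul_le_mul_of_nonpos_right (min_le_right _ _) hc.le
    rw [div_mul_cancel₀ _ hc.ne] at h2
    linarith
  have hmaj : ∀ (l : X →L[ℝ] ℝ) (M : ℝ), (∀ (y : X) (t : ℝ), (t : EReal) ≤ s y → l y + t ≤ M) →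
      p l - ((l x : ℝ) : EReal) ≤ ((M - l x : ℝ) : EReal) := fun l M hl => by
    rw [EReal.coe_sub]
    refine EReal.sub_le_sub ((hp l).trans (iSup_le fun y => ?_)) le_rfl
    induction hy : s y with
    | bot => simp
    | top => exact absurd hy (hs y)
    | coe t => exact_mod_cast hl y t hy.ge
  have hmaj' : ∀ {φ : X →L[ℝ] ℝ} {c u : ℝ}, 0 < c →
      (∀ (y : X) (t : ℝ), (t : EReal) ≤ s y → φ y + t * c < u) →
      ∀ (y : X) (t : ℝ), (t : EReal) ≤ s y → (c⁻¹ • φ) y + t ≤ c⁻¹ * u := fun hc h y t ht => by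
    rw [smul_apply, smul_eq_mul, le_inv_mul_iff₀ hc, mul_add,
      mul_inv_cancel_left₀ hc.ne']
    linarith [h y t ht]
  refine le_of_forall_lt_coe fun r hr => ?_
  obtain ⟨φ, c, u, hc, h1, h2⟩ := hsep x r hr
  rcases hc.eq_or_lt with rfl | hc
  · obtain ⟨φ₀, c₀, u₀, hc₀, h3, h4⟩ := hsep y₀ (s₀ + 1) (by
      rw [hs₀]
      exact_mod_cast lt_add_one s₀)
    have h5 := h3 y₀ s₀ hs₀.ge
    have hc₀' : 0 < c₀ := by nlinarith
    have h6 := hmaj' hc₀' h3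
    have h7 : 0 < φ x - u := by linarith
    obtain ⟨n, hn⟩ := exists_nat_gt ((c₀⁻¹ * u₀ - (c₀⁻¹ • φ₀) x - r) / (φ x - u))
    rw [div_lt_iff₀ h7] at hn
    refine (iInf_le _ (c₀⁻¹ • φ₀ + (n : ℝ) • φ)).trans
      ((hmaj _ (c₀⁻¹ * u₀ + n * u) fun y t ht => ?_).trans ?_)
    · have := h6 y t ht
      have h8 := h1 y t ht
      have h9 : (n : ℝ) * φ y ≤ n * u := by gcongr; linarith
      simp only [add_apply, smul_apply, smul_eq_mul] at *
      linarith
    · rw [EReal.coe_le_coe_iff]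
      simp only [add_apply, smul_apply, smul_eq_mul] at *
      linarith
  · refine (iInf_le _ (c⁻¹ • φ)).trans ((hmaj _ _ (hmaj' hc h1)).trans ?_)
    rw [EReal.coe_le_coe_iff, smul_apply, smul_eq_mul]
    have : c⁻¹ * u ≤ c⁻¹ * (φ x + r * c) := by gcongr
    have e : c⁻¹ * (φ x + r * c) = c⁻¹ * φ x + r := by field_simp
    linarith

variable [MeasurableSpace X] {d : ℕ} {μ : InvSystem d X} {g c : ℕ+ → ℝ} {C₀ : Set (Set X)}

lemma isClosed_hypograph_entropy (hX : IsMeasurableLCS C₀) (ν : ℕ+ → Measure X) :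
    IsClosed (hypograph (entropy d (nbhds C₀) ν)) := by
  rw [← isOpen_compl_iff, isOpen_iff_mem_nhds]
  rintro ⟨y, r⟩ hyr
  have hyr' : entropy d (nbhds C₀) ν y < r := not_le.1 hyr
  obtain ⟨a, ha, har⟩ := EReal.lt_iff_exists_real_btwn.1 hyr'
  obtain ⟨_, hU⟩ := iInf_lt_iff.1 ha
  obtain ⟨⟨C, hC, rfl⟩, hU⟩ := iInf_lt_iff.1 hU
  have hC' : (2⁻¹ : ℝ) • C ∈ C₀ := hX.dilation_mem _ (by norm_num) C hC
  filter_upwards [prod_mem_nhds (vadd_mem_nhds hX hC' y) (Ioi_mem_nhds (EReal.coe_lt_coe_iff.1 har))]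
  rintro ⟨z, t⟩ ⟨hz, ht⟩
  refine not_le.2 (lt_of_le_of_lt ?_ ((hU.trans (EReal.coe_lt_coe_iff.2 ht))))
  refine (entropy_le_liminf ν hC' z).trans (liminf_le_liminf (Eventually.of_forall fun n => ?_))
  refine EReal.div_le_div_right_of_nonneg (by positivity)
    (ENNReal.log_monotone (measure_mono ?_))
  obtain ⟨_, ⟨e, he, rfl⟩, rfl⟩ := hz
  rintro _ ⟨_, ⟨e', he', rfl⟩, rfl⟩
  refine ⟨(2⁻¹ : ℝ) • e + (2⁻¹ : ℝ) • e', (hX.internal C hC).1.convex he he' (by norm_num)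
    (by norm_num) (by norm_num), ?_⟩
  simp only [vadd_eq_add]
  abel

lemma Decoupling.convex_hypograph_entropy (hd : 0 < d) (h : Decoupling μ g c)
    (hX : IsMeasurableLCS C₀) (hctl : μ.LocallyControlled) :
    Convex ℝ (hypograph (entropy d (nbhds C₀) μ.cramer)) := by
  have := hX.topAddGroup
  have := hX.continuousSMul
  refine convex_of_isClosed_of_midpoint (isClosed_hypograph_entropy hX _) ?_
  rintro ⟨x, a⟩ ha ⟨y, b⟩ hb
  change (((2⁻¹ : ℝ) * (a + b) : ℝ) : EReal) ≤
    entropy d (nbhds C₀) μ.cramer ((2⁻¹ : ℝ) • (x + y))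
  refine le_iInf₂ ?_
  rintro _ ⟨C, hC, rfl⟩
  have hC' : (2⁻¹ : ℝ) • C ∈ C₀ := hX.dilation_mem _ (by norm_num) C hC
  have ha' : (a : EReal) ≤ liminf (logRate d μ.cramer (x +ᵥ (2⁻¹ : ℝ) • C)) atTop :=
    le_trans ha (entropy_le_liminf _ hC' x)
  have hb' : (b : EReal) ≤ liminf (logRate d μ.cramer (y +ᵥ (2⁻¹ : ℝ) • C)) atTop :=
    le_trans hb (entropy_le_liminf _ hC' y)
  refine le_of_forall_coe_lt fun r hr => ?_
  have hr' : r < 2⁻¹ * (a + b) := EReal.coe_lt_coe_iff.1 hr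
  set ε := 2⁻¹ * (a + b) - r with hε
  have hε0 : 0 < ε := by linarith
  have key := h.le_liminf_midpoint hd hX.stable hctl (hX.internal C hC)
    (a := a - ε) (b := b - ε)
    (lt_of_lt_of_le (EReal.coe_lt_coe_iff.2 (by linarith)) ha')
    (lt_of_lt_of_le (EReal.coe_lt_coe_iff.2 (by linarith)) hb')
  have e : (a - ε + (b - ε)) / 2 = r := by rw [hε]; ring
  rwa [e] at key

lemma Decoupling.entropy_eq_iInf (hd : 0 < d) (h : Decoupling μ g c) (hX : IsMeasurableLCS C₀)
    (hctl : μ.LocallyControlled) {D : Set X} (hD : Convex ℝ D)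
    (hμD : μ.CarriedBy {σ | ∀ z, σ z ∈ D}) (hT : μ.LocallyConvexTight D) (x : X) :
    entropy d (nbhds C₀) μ.cramer x =
      ⨅ l : X →L[ℝ] ℝ, (pressure d μ.cramer l - ((l x : ℝ) : EReal)) := by
  have := hX.topAddGroup
  have := hX.continuousSMul
  have : LocallyConvexSpace ℝ X := LocallyConvexSpace.ofBasisZero ℝ X _ _ hX.basis
    fun C hC => (hX.internal C hC).1.convex
  have hp := h.pressure_le_iSup hd hX hctl hD hμD hT
  refine le_antisymm (le_iInf fun l => ?_) ?_
  · refine (EReal.le_sub_iff_add_le (by simp) (by simp)).2 ?_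
    rw [add_comm]
    exact coe_add_entropy_le_pressure hX μ l x
  · refine iInf_le_of_convex_hypograph (fun y => ?_) ?_ (h.convex_hypograph_entropy hd hX hctl)
      (isClosed_hypograph_entropy hX _) hp x
    · exact ((entropy_nonpos hX μ y).trans_lt EReal.zero_lt_top).ne
    · by_contra! hbot
      have h1 := (bot_lt_pressure hX.stable hctl (hX.dual_measurable 0)).trans_le (hp 0)
      simp [hbot] at h1

end Duality

end CramerField

open CramerField in
theorem mainTheorem1 {X : Type*} [AddCommGroup X] [Module ℝ X] [MeasurableSpace X]
    [TopologicalSpace X] (C₀ : Set (Set X)) (hX : IsMeasurableLCS C₀)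
    (d : ℕ) (hd : 0 < d) (D : Set X) (hD : Convex ℝ D)
    (μ : InvSystem d X) (hμD : μ.CarriedBy {σ | ∀ z, σ z ∈ D})
    (hdec : μ.LowerDecoupled) (hctl : μ.LocallyControlled) :
    WeakUpperBound d D μ.cramer (entropy d (nbhds C₀) μ.cramer) ∧
    WeakLDP d μ.cramer (entropy d (nbhds C₀) μ.cramer) ∧
    WeakLDP d (fun n => traceMeasure (μ.cramer n) D)
      (entropy d (nbhdsIn C₀ D) (fun n => traceMeasure (μ.cramer n) D)) ∧
    (∀ l : X →L[ℝ] ℝ,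
      Tendsto (logLaplace d μ.cramer l) atTop (𝓝 (pressure d μ.cramer l))) ∧
    (∀ (l : X →L[ℝ] ℝ) (x : X),
      ((l x : ℝ) : EReal) ≤ pressure d μ.cramer l - entropy d (nbhds C₀) μ.cramer x) ∧
    (μ.LocallyConvexTight D → ∀ x : X, entropy d (nbhds C₀) μ.cramer x =
      ⨅ l : X →L[ℝ] ℝ, (pressure d μ.cramer l - ((l x : ℝ) : EReal))) := by
  obtain ⟨g, c, h⟩ := exists_decoupling hdec
  exact ⟨h.weakUpperBound hd hX hctl hD hμD, h.weakLDP hd hX hctl,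
    h.weakLDP_trace hd hX hctl hD hμD,
    fun l => h.tendsto_logLaplace hX.stable hctl (hX.dual_measurable l),
    fun l x => coe_le_pressure_sub_entropy hX hctl l x,
    fun hT x => h.entropy_eq_iInf hd hX hctl hD hμD hT x⟩
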